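/- Let $\mathsf{F}$ be a finite field with $q$ elements, and let $\ell,\sigma,\tau,\upsilon$ be the constants attached to $q$ by the following table. | $q$ | $\ell$ | $\sigma$ | $\tau$ | $\upsilon$ | |---|---|---|---|---| | $2$ | $8$ | $\frac{43}{2}$ | $17$ | $41$ | | $3$ | $5$ | $16$ | $11$ | $55$ | | $4$ | $4$ | $\frac{225}{16}$ | $9$ | $65$ | | $5$ | $4$ | $\frac{64}{5}$ | $8$ | $75$ | | $7$ | $3$ | $\frac{78}{7}$ | $7$ | $96$ | | $8$ | $3$ | $\frac{21}{2}$ | $6$ | $108$ | | $9$ | $3$ | $\frac{88}{9}$ | $6$ | $124$ | | $11$ | $3$ | $\frac{105}{11}$ | $6$ | $136$ | | $13$ | $3$ | $\frac{120}{13}$ | $6$ | $150$ | | $16$–$19$ | $2$ | $\frac{9(q-1)}{q}$ | $5$ | $194$ | | $23$–$29$ | $2$ | $\frac{8(q-1)}{q}$ | $4$ | $285$ | | $31$–$43$ | $2$ | $\frac{15(q-1)}{2q}$ | $4$ | $381$ | | $47$–$59$ | $2$ | $\frac{7(q-1)}{q}$ | $4$ | $577$ | | $61$–$71$ | $2$ |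 $\frac{27(q-1)}{4q}$ | $4$ | $783$ | | $73$–$83$ | $2$ | $\frac{33(q-1)}{5q}$ | $4$ | $996$ | | $\ge 89$ | $2$ | $\frac{13(q-1)}{2q}$ | $4$ | $1213$ | Let $m,n$ be integers with $n \ge m \ge 0$. Then there is a random procedure generating $n-m+\ell$ row vectors of length $n$ over $\mathsf{F}$ (that is, a probability distribution on $\mathsf{F}^{(n-m+\ell)\times n}$, depending only on $\mathsf{F}$, $m$ and $n$) with the following properties. 1. If $n-m\ge\upsilon$, then the expected number of nonzero entries in the generated rows is at most $\sigma n\ln n+\tau n$. If $n-m<\upsilon$, then it is at most $\frac{q-1}{q}(n-m+\ell)n\le\frac{q-1}{q}(\upsilon+\ell)n$. 2. For every matrix $A\in\mathsf{F}^{m\times n}$ of rank $m$, the matrix $B\in\mathsf{F}^{(n+\ell)\times n}$ obtained by appending the generated rows to $A$ has rank $n$ with probability at least $\frac{9}{10}$ if $q\le n^2$, and with probability at least $\frac{9}{10}-\frac{9}{10n}$ if $q>n^2$ (for $n=0$ the term $\frac{9}{10n}$ is read as $0$). -/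

import Mathlib

namespace SparseConditioner

/-- The constants attached to a field size `q`: the number `ell` of extra rows, the coefficients
`sigma` and `tau` of `n ln n` and `n`, and the threshold `upsilon` for `n - m`. -/
structure Constants where
  ell : ℕ
  sigma : ℝ
  tau : ℝ
  upsilon : ℕ

/-- The table of constants. Its rows cover every prime power `q`; the last line is the
row `q ≥ 89`. -/
noncomputable def constants (q : ℕ) : Constants :=
  if q = 2 then ⟨8, 43 / 2, 17, 41⟩
  else if q = 3 then ⟨5, 16, 11, 55⟩
  else if q = 4 then ⟨4, 225 / 16, 9, 65⟩
  else if q = 5 then ⟨4, 64 / 5, 8, 75⟩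
  else if q = 7 then ⟨3, 78 / 7, 7, 96⟩
  else if q = 8 then ⟨3, 21 / 2, 6, 108⟩
  else if q = 9 then ⟨3, 88 / 9, 6, 124⟩
  else if q = 11 then ⟨3, 105 / 11, 6, 136⟩
  else if q = 13 then ⟨3, 120 / 13, 6, 150⟩
  else if 16 ≤ q ∧ q ≤ 19 then ⟨2, 9 * ((q : ℝ) - 1) / q, 5, 194⟩
  else if 23 ≤ q ∧ q ≤ 29 then ⟨2, 8 * ((q : ℝ) - 1) / q, 4, 285⟩
  else if 31 ≤ q ∧ q ≤ 43 then ⟨2, 15 * ((q : ℝ) - 1) / (2 * q), 4, 381⟩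
  else if 47 ≤ q ∧ q ≤ 59 then ⟨2, 7 * ((q : ℝ) - 1) / q, 4, 577⟩
  else if 61 ≤ q ∧ q ≤ 71 then ⟨2, 27 * ((q : ℝ) - 1) / (4 * q), 4, 783⟩
  else if 73 ≤ q ∧ q ≤ 83 then ⟨2, 33 * ((q : ℝ) - 1) / (5 * q), 4, 996⟩
  else ⟨2, 13 * ((q : ℝ) - 1) / (2 * q), 4, 1213⟩

open scoped Classical in
/-- The number of nonzero entries of a matrix. -/
noncomputable def nonzeroEntries {F : Type*} [Zero F] {r n : ℕ}
    (R : Matrix (Fin r) (Fin n) F) : ℕ :=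
  ∑ i, hammingNorm (R i)

open scoped Classical in
/-- The expected number of nonzero entries of a random `r × n` matrix with distribution `μ`. -/
noncomputable def expectedNonzeroEntries {F : Type*} [Field F] [Fintype F] {r n : ℕ}
    (μ : PMF (Matrix (Fin r) (Fin n) F)) : ℝ :=
  ∑ R, (μ R).toReal * (nonzeroEntries R : ℝ)

/-- The probability that appending to `A` a block of `r` rows with distribution `μ` gives a matrix
of rank `n`, the number of columns. -/
noncomputable def probFullRank {F : Type*} [Field F] {m r n : ℕ}
    (μ : PMF (Matrix (Fin r) (Fin n) F)) (A : Matrix (Fin m) (Fin n) F) : ℝ :=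
  (μ.toOuterMeasure {R | (Matrix.fromRows A R).rank = n}).toReal

end SparseConditioner

/-! Write k = n - m and r = k + ℓ. The new entries are independent: with probability π = min(1, L/r)
uniform on F, otherwise zero. Above the threshold L = a ln k + 4, with a = 13 for q = 2 and a = 13/2
otherwise; below it π = 1. The expected cost r n (1 - 1/q) π is at most (1 - 1/q) L n, which fits
the budget (`expected_cost_le`).

Rank n can fail only if all new rows kill some nonzero w in ker A. Such a w is determined by its
coordinates in a set J of k columns, so a union bound over F^J applies
(`sum_matrixWeight_singular_le`). One row kills a vector of weight i with probability 1/q + (1 -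
1/q)(1 - π)^i. The r-th power of this is bounded separately for light, middle and heavy weights, by
geometric sequences in i or by a constant (`vanishProb_pow_le`), and summed through Σ x^(weight) =
(1 + (q - 1)x)^k. The three ranges contribute at most 0.0102, 0.0058 and 2.72 q^(-ℓ); as q^ℓ ≥ 34,
the total is at most 1/10.

These estimates need ln q to be small compared with L, so q > 20k is treated by comparison with the
field of 89 elements at equal density. The zero pattern of the rows does not depend on the field. If
it contains no matching of J into the rows, the matrix is singular over every field by Hall's
theorem, so this event is bounded by the estimate over 89 elements. If it contains one, revealing
the matched rows one by one keeps a determinant nonzero except with probability k/(q - 1) ≤ 1/20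
(`sum_matrixWeight_singular_le_of_other_field`). -/

namespace SparseConditioner

open Finset

/-! ### Expectations under finite product distributions. -/

section ProductWeights

variable {ι α : Type*} [Fintype ι] [DecidableEq ι] [Fintype α]

theorem sum_prod_eq_one (w : ι → α → ℝ) (hw : ∀ i, ∑ a, w i a = 1) :
    ∑ x : ι → α, ∏ i, w i (x i) = 1 := by
  have h := Finset.prod_univ_sum (fun _ : ι => (Finset.univ : Finset α)) w
  rw [Fintype.piFinset_univ] at h
  rw [← h]
  simp [hw]

theorem sum_prod_apply (w : ι → α → ℝ) (hw : ∀ i, ∑ a, w i a = 1) (e : ι) (g : α → ℝ) :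
    ∑ x : ι → α, (∏ i, w i (x i)) * g (x e) = ∑ a, w e a * g a := by
  have h := Finset.prod_univ_sum (fun _ : ι => (Finset.univ : Finset α))
    (fun i a => w i a * if i = e then g a else 1)
  rw [Fintype.piFinset_univ] at h
  simp only [Finset.prod_mul_distrib] at h
  simp only [Finset.prod_ite_eq', Finset.mem_univ, if_true] at h
  rw [← h, Finset.prod_eq_single e]
  · simp
  · intro b _ hb
    simp [hb, hw]
  · simp

/-- Resampling one coordinate of a product distribution does not change an expectation. -/
theorem sum_prod_resample (w : ι → α → ℝ) (hw : ∀ i, ∑ a, w i a = 1) (e : ι)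
    (g : (ι → α) → ℝ) :
    ∑ x : ι → α, (∏ i, w i (x i)) * g x =
      ∑ x : ι → α, (∏ i, w i (x i)) * ∑ a, w e a * g (Function.update x e a) := by
  have split : ∀ x : ι → α, ∏ i, w i (x i) = w e (x e) * ∏ i : {j // j ≠ e}, w i (x i) := by
    intro x
    rw [← Finset.mul_prod_erase univ _ (mem_univ e)]
    congr 1
    apply Finset.prod_subtype
    simp
  have hsum : ∀ h : (ι → α) → ℝ, ∑ x, h x =
      ∑ a : α, ∑ y : {j // j ≠ e} → α, h ((Equiv.funSplitAt e α).symm (a, y)) := by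
    intro h
    rw [← Fintype.sum_prod_type', ← (Equiv.funSplitAt e α).symm.sum_comp]
  have he : ∀ a y, (Equiv.funSplitAt e α).symm (a, y) e = a := by
    intro a y; simp [Equiv.funSplitAt, Equiv.piSplitAt]
  have hne : ∀ a y (i : {j // j ≠ e}), (Equiv.funSplitAt e α).symm (a, y) i = y i := by
    intro a y i; simp [Equiv.funSplitAt, Equiv.piSplitAt, i.2]
  have hup : ∀ a y b, Function.update ((Equiv.funSplitAt e α).symm (a, y)) e b =
      (Equiv.funSplitAt e α).symm (b, y) := by
    intro a y b
    ext i
    by_cases hi : i = e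
    · subst hi; simp [he]
    · rw [Function.update_of_ne hi, hne a y ⟨i, hi⟩, hne b y ⟨i, hi⟩]
  rw [hsum, hsum]
  simp only [split, he, hne, hup]
  rw [Finset.sum_comm]
  conv_rhs => rw [Finset.sum_comm]
  refine Finset.sum_congr rfl fun y _ => ?_
  simp only [mul_assoc, ← Finset.sum_mul, hw, one_mul]
  rw [Finset.mul_sum]
  exact Finset.sum_congr rfl fun a _ => by ring

end ProductWeights

/-! ### Sparse random entries and the law of a row times a vector. -/

section Entries

variable {F : Type*} [Field F] [Fintype F]

open scoped Classical in
/-- The distribution of an element of `F` that is nonzero with probability `p`, all nonzero values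
being equally likely. -/
noncomputable def entryWeight (F : Type*) [Field F] [Fintype F] (p : ℝ) (x : F) : ℝ :=
  if x = 0 then 1 - p else p / ((Fintype.card F : ℝ) - 1)

theorem one_lt_card_real (F : Type*) [Field F] [Fintype F] : (1 : ℝ) < Fintype.card F := by
  exact_mod_cast Fintype.one_lt_card

theorem entryWeight_nonneg {p : ℝ} (h0 : 0 ≤ p) (h1 : p ≤ 1) (x : F) : 0 ≤ entryWeight F p x := by
  have := one_lt_card_real F
  unfold entryWeight
  split_ifs
  · linarith
  · apply div_nonneg h0; linarith

theorem card_nonzero_real (F : Type*) [Field F] [Fintype F] [DecidableEq F] :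
    ((#{x : F | x ≠ 0} : ℕ) : ℝ) = (Fintype.card F : ℝ) - 1 := by
  rw [Finset.filter_ne', Finset.card_erase_of_mem (mem_univ _), Finset.card_univ,
    Nat.cast_sub Fintype.card_pos]
  simp

theorem sum_entryWeight_mul (p : ℝ) (g : F → ℝ) :
    ∑ x, entryWeight F p x * g x =
      (1 - p - p / ((Fintype.card F : ℝ) - 1)) * g 0 +
        p / ((Fintype.card F : ℝ) - 1) * ∑ x, g x := by
  classical
  have : ∀ x : F, entryWeight F p x * g x =
      (if x = 0 then (1 - p - p / ((Fintype.card F : ℝ) - 1)) * g 0 else 0) +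
        p / ((Fintype.card F : ℝ) - 1) * g x := by
    intro x
    unfold entryWeight
    split_ifs with h
    · subst h; ring
    · ring
  simp only [this, Finset.sum_add_distrib, Finset.mul_sum]
  simp

theorem sum_entryWeight (p : ℝ) : ∑ x, entryWeight F p x = 1 := by
  have h := sum_entryWeight_mul (F := F) p (fun _ => 1)
  have h1 := one_lt_card_real F
  simp only [mul_one, sum_const, card_univ, nsmul_eq_mul] at h
  rw [h]
  field_simp [show (Fintype.card F : ℝ) - 1 ≠ 0 by linarith]
  ring

/-- The density of nonzero entries of an element that is uniform with probability `π` and zero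
otherwise. -/
noncomputable def density (F : Type*) [Fintype F] (π : ℝ) : ℝ :=
  (1 - 1 / (Fintype.card F : ℝ)) * π

theorem density_bounds {π : ℝ} (h0 : 0 ≤ π) (h1 : π ≤ 1) :
    0 ≤ density F π ∧ density F π ≤ 1 := by
  have hq := one_lt_card_real F
  have : 0 < 1 / (Fintype.card F : ℝ) := by positivity
  have h2 : 1 / (Fintype.card F : ℝ) < 1 := by rw [div_lt_one] <;> linarith
  unfold density
  constructor
  · apply mul_nonneg <;> linarith
  · nlinarith

theorem sum_entryWeight_density_mul (π : ℝ) (g : F → ℝ) :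
    ∑ x, entryWeight F (density F π) x * g x =
      (1 - π) * g 0 + π / Fintype.card F * ∑ x, g x := by
  rw [sum_entryWeight_mul]
  have hq := one_lt_card_real F
  have h1 : density F π / ((Fintype.card F : ℝ) - 1) = π / Fintype.card F := by
    unfold density
    field_simp [show (Fintype.card F : ℝ) - 1 ≠ 0 by linarith]
  rw [h1]
  congr 2
  unfold density
  field_simp
  ring

/-- The probability that a combination with `i` nonzero coefficients of independent elements, each
uniform with probability `π` and zero otherwise, vanishes. -/
noncomputable def vanishProb (q : ℕ) (π : ℝ) (i : ℕ) : ℝ :=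
  1 / (q : ℝ) + (1 - 1 / (q : ℝ)) * (1 - π) ^ i

theorem vanishProb_nonneg {q : ℕ} (hq : 1 ≤ q) {π : ℝ} (h1 : π ≤ 1) (i : ℕ) :
    0 ≤ vanishProb q π i := by
  have : (1 : ℝ) ≤ q := by exact_mod_cast hq
  have h2 : 1 / (q : ℝ) ≤ 1 := by rw [div_le_one] <;> linarith
  have : 0 ≤ 1 / (q : ℝ) := by positivity
  unfold vanishProb
  have := pow_nonneg (sub_nonneg.2 h1) i
  have := mul_nonneg (sub_nonneg.2 h2) this
  linarith

theorem vanishProb_antitone {q : ℕ} (hq : 1 ≤ q) {π : ℝ} (h0 : 0 ≤ π) (h1 : π ≤ 1) :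
    Antitone (vanishProb q π) := by
  intro i j hij
  have : (1 : ℝ) ≤ q := by exact_mod_cast hq
  have h2 : 1 / (q : ℝ) ≤ 1 := by rw [div_le_one] <;> linarith
  unfold vanishProb
  have := pow_le_pow_of_le_one (sub_nonneg.2 h1) (by linarith) hij
  have := mul_le_mul_of_nonneg_left this (sub_nonneg.2 h2)
  linarith

open scoped Classical in
-- If some entry on the support of `w` is drawn uniformly, the product is uniform; otherwise it is
-- zero. The target `c` is arbitrary because removing the first entry shifts it in the induction.
theorem sum_prod_entryWeight_dotProduct (π : ℝ) {n : ℕ} (w : Fin n → F) (c : F) :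
    ∑ r : Fin n → F, (∏ j, entryWeight F (density F π) (r j)) * (if r ⬝ᵥ w = c then 1 else 0) =
      1 / (Fintype.card F : ℝ) +
        ((if c = 0 then 1 else 0) - 1 / (Fintype.card F : ℝ)) * (1 - π) ^ hammingNorm w := by
  induction n generalizing c with
  | zero =>
    have : hammingNorm w = 0 := by rw [hammingNorm_eq_zero]; exact Subsingleton.elim _ _
    simp [this, eq_comm]
  | succ n ih =>
    rw [← (Fin.consEquiv fun _ : Fin (n + 1) => F).sum_comp, Fintype.sum_prod_type]
    have hcons : ∀ (x : F) (r : Fin n → F), (Fin.consEquiv fun _ : Fin (n + 1) => F) (x, r) =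
        (Fin.cons x r : Fin (n + 1) → F) := fun _ _ => rfl
    have hdot : ∀ (x : F) (r : Fin n → F), (Fin.cons x r : Fin (n + 1) → F) ⬝ᵥ w = c ↔
        r ⬝ᵥ Fin.tail w = c - x * w 0 := by
      intro x r
      have : (Fin.cons x r : Fin (n + 1) → F) ⬝ᵥ w = r ⬝ᵥ Fin.tail w + x * w 0 := by
        simp [dotProduct, Fin.sum_univ_succ, Fin.tail, add_comm]
      rw [this, eq_sub_iff_add_eq]
    simp only [hcons, hdot, Fin.prod_univ_succ, Fin.cons_zero, Fin.cons_succ, mul_assoc,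
      ← Finset.mul_sum, ih]
    rw [sum_entryWeight_density_mul]
    have hq := one_lt_card_real F
    by_cases h0 : w 0 = 0
    · have hn : hammingNorm w = hammingNorm (Fin.tail w) := by
        unfold hammingNorm
        rw [Fin.card_filter_univ_succ]
        simp only [h0, Fin.tail, ne_eq, not_true_eq_false, if_false]
        congr!
      simp only [h0, mul_zero, sub_zero, hn, sum_const, card_univ, nsmul_eq_mul]
      field_simp
      ring
    · have hn : hammingNorm w = hammingNorm (Fin.tail w) + 1 := by
        unfold hammingNorm
        rw [Fin.card_filter_univ_succ]
        simp only [h0, Fin.tail, ne_eq, not_false_eq_true, if_true]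
        congr!
      have hs : ∑ x : F, (if c - x * w 0 = 0 then (1 : ℝ) else 0) = 1 := by
        rw [Finset.sum_eq_single (c / w 0)]
        · simp [h0]
        · intro b _ hb
          rw [if_neg]
          intro h
          apply hb
          rw [eq_div_iff h0]
          exact (sub_eq_zero.1 h).symm
        · simp
      simp only [Finset.sum_add_distrib, ← Finset.sum_mul, Finset.sum_sub_distrib, hs, hn,
        sum_const, card_univ, nsmul_eq_mul, zero_mul, sub_zero]
      field_simp
      ring

open scoped Classical in
-- Each coordinate contributes the factor 1 + (q - 1)x. This sums geometric bounds in the weight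
-- over a whole coordinate space.
theorem sum_pow_hammingNorm {ι : Type*} [Fintype ι] [DecidableEq ι] (x : ℝ) :
    ∑ v : ι → F, x ^ hammingNorm v = (1 + ((Fintype.card F : ℝ) - 1) * x) ^ Fintype.card ι := by
  have h := Finset.prod_univ_sum (fun _ : ι => (Finset.univ : Finset F))
    (fun _ a => if a ≠ 0 then x else 1)
  rw [Fintype.piFinset_univ] at h
  simp only [Finset.prod_const, Finset.card_univ] at h
  have h1 : ∑ a : F, (if a ≠ 0 then x else 1) = 1 + ((Fintype.card F : ℝ) - 1) * x := by
    rw [Finset.sum_ite, sum_const, nsmul_eq_mul, card_nonzero_real]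
    have : #{a : F | ¬a ≠ 0} = 1 := by
      rw [Finset.card_eq_one]
      exact ⟨0, by ext; simp⟩
    rw [sum_const, nsmul_eq_mul, this]
    push_cast
    ring
  rw [h1] at h
  rw [h]
  refine Finset.sum_congr rfl fun v _ => ?_
  rw [Finset.prod_ite]
  simp [hammingNorm]

end Entries

/-! ### Random matrices and the union bound over a subspace. -/

section MatrixWeights

variable {F : Type*} [Field F] [Fintype F] {r n : ℕ}

/-- The product weight of a matrix whose entry `(i, j)` is nonzero with probability `P i j`. -/
noncomputable def matrixWeight (P : Fin r → Fin n → ℝ) (R : Fin r → Fin n → F) : ℝ :=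
  ∏ i, ∏ j, entryWeight F (P i j) (R i j)

theorem matrixWeight_nonneg {P : Fin r → Fin n → ℝ} (h0 : ∀ i j, 0 ≤ P i j)
    (h1 : ∀ i j, P i j ≤ 1) (R : Fin r → Fin n → F) : 0 ≤ matrixWeight P R :=
  prod_nonneg fun i _ => prod_nonneg fun j _ => entryWeight_nonneg (h0 i j) (h1 i j) _

theorem sum_rowWeight (P : Fin n → ℝ) : ∑ x : Fin n → F, ∏ j, entryWeight F (P j) (x j) = 1 :=
  sum_prod_eq_one _ fun _ => sum_entryWeight _

theorem sum_matrixWeight (P : Fin r → Fin n → ℝ) :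
    ∑ R : Fin r → Fin n → F, matrixWeight P R = 1 :=
  sum_prod_eq_one (fun i (x : Fin n → F) => ∏ j, entryWeight F (P i j) (x j))
    fun _ => sum_rowWeight _

/-- The event that the matrix is not injective on `W`. -/
def Singular (W : Set (Fin n → F)) (R : Fin r → Fin n → F) : Prop :=
  ∃ w ∈ W, w ≠ 0 ∧ ∀ i, R i ⬝ᵥ w = 0

open scoped Classical in
-- Union bound over `W`, with independent rows giving the r-th power. Restriction to `J` is
-- injective on `W` and can only lower the weight, which only raises `vanishProb`.
theorem sum_matrixWeight_singular_le (W : Submodule F (Fin n → F)) (J : Finset (Fin n))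
    (hJ : ∀ w ∈ W, (∀ j ∈ J, w j = 0) → w = 0) {π : ℝ} (h0 : 0 ≤ π) (h1 : π ≤ 1) :
    ∑ R : Fin r → Fin n → F, matrixWeight (fun _ _ => density F π) R *
        (if Singular (W : Set (Fin n → F)) R then 1 else 0) ≤
      ∑ v : J → F, if v = 0 then 0 else vanishProb (Fintype.card F) π (hammingNorm v) ^ r := by
  have hq : 1 ≤ Fintype.card F := Fintype.card_pos
  set S : Finset (Fin n → F) := {w | w ∈ W ∧ w ≠ 0} with hS
  have hprob : ∀ w : Fin n → F, ∑ R : Fin r → Fin n → F,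
      matrixWeight (fun _ _ => density F π) R * ∏ i, (if R i ⬝ᵥ w = 0 then (1 : ℝ) else 0) =
      vanishProb (Fintype.card F) π (hammingNorm w) ^ r := by
    intro w
    have h := Finset.prod_univ_sum (fun _ : Fin r => (Finset.univ : Finset (Fin n → F)))
      (fun _ x => (∏ j, entryWeight F (density F π) (x j)) * (if x ⬝ᵥ w = 0 then 1 else 0))
    rw [Fintype.piFinset_univ] at h
    simp only [Finset.prod_mul_distrib, sum_prod_entryWeight_dotProduct, if_true,
      Finset.prod_const, Finset.card_univ, Fintype.card_fin] at h
    exact h.symm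
  calc _ ≤ ∑ R : Fin r → Fin n → F, matrixWeight (fun _ _ => density F π) R *
        ∑ w ∈ S, ∏ i, (if R i ⬝ᵥ w = 0 then (1 : ℝ) else 0) := by
        refine sum_le_sum fun R _ => mul_le_mul_of_nonneg_left ?_
          (matrixWeight_nonneg (fun _ _ => (density_bounds h0 h1).1)
            (fun _ _ => (density_bounds h0 h1).2) R)
        have hnn : ∀ w ∈ S, 0 ≤ ∏ i, (if R i ⬝ᵥ w = 0 then (1 : ℝ) else 0) := fun w _ =>
          prod_nonneg fun i _ => by split_ifs <;> norm_num
        split_ifs with hR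
        · obtain ⟨w, hw, hw0, hRw⟩ := hR
          refine le_trans ?_ (single_le_sum hnn (show w ∈ S by simp [hS, hw0]; exact hw))
          simp [hRw]
        · exact sum_nonneg hnn
    _ = ∑ w ∈ S, vanishProb (Fintype.card F) π (hammingNorm w) ^ r := by
        simp only [Finset.mul_sum]
        rw [sum_comm]
        exact sum_congr rfl fun w _ => hprob w
    _ ≤ ∑ w ∈ S, vanishProb (Fintype.card F) π (hammingNorm fun j : J => w j) ^ r := by
        refine sum_le_sum fun w _ => ?_
        refine pow_le_pow_left₀ (vanishProb_nonneg hq h1 _) (vanishProb_antitone hq h0 h1 ?_) _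
        unfold hammingNorm
        refine Finset.card_le_card_of_injOn (fun j => (j : Fin n)) ?_ ?_
        · intro j hj
          simpa using hj
        · intro a _ b _ h
          exact Subtype.ext h
    _ = ∑ v ∈ S.image (fun w (j : J) => w j),
          vanishProb (Fintype.card F) π (hammingNorm v) ^ r := by
        rw [sum_image]
        intro a ha b hb hab
        simp only [hS, coe_filter, mem_univ, true_and, Set.mem_ofPred_eq] at ha hb
        rw [← sub_eq_zero]
        refine hJ _ (W.sub_mem ha.1 hb.1) fun j hj => ?_
        have := congrFun hab ⟨j, hj⟩
        simpa [sub_eq_zero] using this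
    _ ≤ ∑ v ∈ ({v | v ≠ 0} : Finset (J → F)),
          vanishProb (Fintype.card F) π (hammingNorm v) ^ r := by
        refine sum_le_sum_of_subset_of_nonneg ?_ fun v _ _ =>
          pow_nonneg (vanishProb_nonneg hq h1 _) _
        intro v hv
        obtain ⟨w, hw, rfl⟩ := mem_image.1 hv
        simp only [hS, mem_filter, mem_univ, true_and] at hw ⊢
        intro h
        exact hw.2 (hJ w hw.1 fun j hj => congrFun h ⟨j, hj⟩)
    _ = _ := by
        rw [sum_filter]
        refine sum_congr rfl fun v _ => ?_
        by_cases hv : v = 0 <;> simp [hv]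

end MatrixWeights

/-! ### Zero patterns, matchings, and comparison between two fields. -/

section Patterns

variable {F : Type*} [Field F] [Fintype F] {r n : ℕ}

/-- The probability of a zero-nonzero pattern with independent entries of density `p`. -/
noncomputable def patternWeight (p : ℝ) (T : Fin r → Fin n → Bool) : ℝ :=
  ∏ i, ∏ j, if T i j then p else 1 - p

/-- The entrywise density, `0` or `1`, prescribed by a pattern. -/
def patternDensity (T : Fin r → Fin n → Bool) (i : Fin r) (j : Fin n) : ℝ :=
  if T i j then 1 else 0

theorem patternWeight_nonneg {p : ℝ} (h0 : 0 ≤ p) (h1 : p ≤ 1) (T : Fin r → Fin n → Bool) :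
    0 ≤ patternWeight p T :=
  prod_nonneg fun i _ => prod_nonneg fun j _ => by split_ifs <;> linarith

theorem sum_patternWeight (p : ℝ) : ∑ T : Fin r → Fin n → Bool, patternWeight p T = 1 := by
  refine sum_prod_eq_one (fun _ (x : Fin n → Bool) => ∏ j, if x j then p else 1 - p) fun _ => ?_
  exact sum_prod_eq_one (fun _ (b : Bool) => if b then p else 1 - p) fun _ => by simp

theorem patternDensity_bounds (T : Fin r → Fin n → Bool) (i : Fin r) (j : Fin n) :
    0 ≤ patternDensity T i j ∧ patternDensity T i j ≤ 1 := by
  unfold patternDensity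
  split_ifs <;> norm_num

/-- An entry can be drawn in two stages: whether it vanishes, then a uniform nonzero value. Only the
second stage sees the field. -/
theorem matrixWeight_eq_sum_pattern (p : ℝ) (R : Fin r → Fin n → F) :
    matrixWeight (fun _ _ => p) R =
      ∑ T : Fin r → Fin n → Bool, patternWeight p T * matrixWeight (patternDensity T) R := by
  have key : ∀ x : F, entryWeight F p x =
      ∑ b : Bool, (if b then p else 1 - p) * entryWeight F (if b then 1 else 0) x := by
    intro x
    unfold entryWeight
    split_ifs <;> simp [*]
    rw [div_eq_mul_inv]
  have hrow : ∀ y : Fin n → F, ∏ j, entryWeight F p (y j) = ∑ t : Fin n → Bool,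
      ∏ j, ((if t j then p else 1 - p) * entryWeight F (if t j then 1 else 0) (y j)) := by
    intro y
    simp only [key]
    rw [Finset.prod_univ_sum, Fintype.piFinset_univ]
  unfold matrixWeight
  simp only [hrow]
  rw [Finset.prod_univ_sum, Fintype.piFinset_univ]
  simp only [prod_mul_distrib]
  rfl

theorem sum_matrixWeight_mul_eq_sum_pattern (p : ℝ) (g : (Fin r → Fin n → F) → ℝ) :
    ∑ R : Fin r → Fin n → F, matrixWeight (fun _ _ => p) R * g R =
      ∑ T : Fin r → Fin n → Bool, patternWeight p T *
        ∑ R : Fin r → Fin n → F, matrixWeight (patternDensity T) R * g R := by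
  simp only [matrixWeight_eq_sum_pattern, sum_mul, mul_sum]
  rw [sum_comm]
  simp only [mul_assoc]

/-- The columns in `J` can be matched to distinct rows inside the pattern. -/
def HasMatching (J : Finset (Fin n)) (T : Fin r → Fin n → Bool) : Prop :=
  ∃ f : J → Fin r, Function.Injective f ∧ ∀ j, T (f j) j = true

/-- Hall's condition by dimension: vectors supported on a set s of columns are seen only by the rows
whose pattern meets s, so injectivity embeds F^s into F^N for that set N of rows, and |s| ≤ |N|. -/
theorem hasMatching_of_not_singular (J : Finset (Fin n)) (T : Fin r → Fin n → Bool)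
    (R : Fin r → Fin n → F) (hT : ∀ i j, T i j = false → R i j = 0)
    (hR : ¬ Singular {w : Fin n → F | ∀ j, j ∉ J → w j = 0} R) : HasMatching J T := by
  classical
  have hall := (Finset.all_card_le_biUnion_card_iff_exists_injective
    (fun j : J => ({i | T i j = true} : Finset (Fin r)))).1 ?_
  · obtain ⟨f, hf, hf'⟩ := hall
    exact ⟨f, hf, fun j => by simpa using hf' j⟩
  intro s
  set N : Finset (Fin r) := s.biUnion fun j => ({i | T i j = true} : Finset (Fin r)) with hN
  let ext : (s → F) → Fin n → F := fun v c =>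
    if h : ∃ hc : c ∈ J, (⟨c, hc⟩ : J) ∈ s then v ⟨⟨c, h.1⟩, h.2⟩ else 0
  have hext : ∀ (v : s → F) (j : s), ext v (j : J) = v j := by
    intro v j
    have h : ∃ hc : ((j : J) : Fin n) ∈ J, (⟨((j : J) : Fin n), hc⟩ : J) ∈ s :=
      ⟨(j : J).2, j.2⟩
    simp only [ext, dif_pos h]
  have hinj : Function.Injective fun (v : s → F) (i : N) => R i ⬝ᵥ ext v := by
    intro v v' hvv
    by_contra hne
    apply hR
    have hsub : ∀ c, ext v c - ext v' c = ext (v - v') c := by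
      intro c
      simp only [ext]
      split_ifs <;> simp
    refine ⟨ext (v - v'), ?_, ?_, ?_⟩
    · intro j hj
      simp only [ext]
      rw [dif_neg]
      rintro ⟨hc, -⟩
      exact hj hc
    · intro h0
      apply hne
      ext j
      have := congrFun h0 (j : J)
      rw [hext] at this
      simpa [sub_eq_zero] using this
    · intro i
      by_cases hi : i ∈ N
      · have h := congrFun hvv ⟨i, hi⟩
        simp only at h
        have : ext (v - v') = ext v - ext v' := by
          ext c; rw [← hsub]; rfl
        rw [this, dotProduct_sub, h, sub_self]
      · rw [dotProduct]
        refine sum_eq_zero fun c _ => ?_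
        by_cases hc : ∃ hc : c ∈ J, (⟨c, hc⟩ : J) ∈ s
        · have : T i c = false := by
            by_contra hT'
            apply hi
            rw [hN, mem_biUnion]
            exact ⟨⟨c, hc.1⟩, hc.2, by simpa using hT'⟩
          rw [hT i c this, zero_mul]
        · simp only [ext, dif_neg hc, mul_zero]
  have hcard := Fintype.card_le_of_injective _ hinj
  simp only [Fintype.card_fun, Fintype.card_coe] at hcard
  exact (Nat.pow_le_pow_iff_right Fintype.one_lt_card).1 hcard

open scoped Classical in
-- A pattern without a matching carries only singular matrices. The left side does not involve `F`,
-- so any convenient field may be used to bound it.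
theorem sum_patternWeight_not_hasMatching_le (J : Finset (Fin n)) {p : ℝ} (h0 : 0 ≤ p)
    (h1 : p ≤ 1) :
    ∑ T : Fin r → Fin n → Bool, patternWeight p T * (if HasMatching J T then 0 else 1) ≤
      ∑ R : Fin r → Fin n → F, matrixWeight (fun _ _ => p) R *
        (if Singular {w : Fin n → F | ∀ j, j ∉ J → w j = 0} R then 1 else 0) := by
  rw [sum_matrixWeight_mul_eq_sum_pattern]
  refine sum_le_sum fun T _ => mul_le_mul_of_nonneg_left ?_ (patternWeight_nonneg h0 h1 T)
  have hnn : ∀ R : Fin r → Fin n → F, 0 ≤ matrixWeight (patternDensity T) R :=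
    matrixWeight_nonneg (fun i j => (patternDensity_bounds T i j).1)
      (fun i j => (patternDensity_bounds T i j).2)
  split_ifs with hT
  · exact sum_nonneg fun R _ => mul_nonneg (hnn R) (by split_ifs <;> norm_num)
  · refine le_trans (le_of_eq (sum_matrixWeight (F := F) (patternDensity T)).symm) ?_
    refine sum_le_sum fun R _ => ?_
    by_cases hR : Singular {w : Fin n → F | ∀ j, j ∉ J → w j = 0} R
    · simp [hR]
    · have : matrixWeight (patternDensity T) R = 0 := by
        by_contra hne
        refine hT (hasMatching_of_not_singular J T R (fun i j hij => ?_) hR)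
        by_contra hRij
        apply hne
        refine prod_eq_zero (mem_univ i) (prod_eq_zero (mem_univ j) ?_)
        simp [entryWeight, patternDensity, hij, hRij]
      simp [this]

open scoped Classical in
-- Once the other coordinates are fixed, exactly one value of coordinate `j` makes the product
-- vanish.
theorem sum_prod_dotProduct_eq_zero_le (e : Fin n → F → ℝ) (he : ∀ j, ∑ x, e j x = 1)
    (hnn : ∀ j x, 0 ≤ e j x) (D : Fin n → F) (j : Fin n) (hD : D j ≠ 0) {ε : ℝ}
    (hε : ∀ x, e j x ≤ ε) :
    ∑ x : Fin n → F, (∏ j, e j (x j)) * (if x ⬝ᵥ D = 0 then 1 else 0) ≤ ε := by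
  rw [sum_prod_resample e he j]
  calc _ ≤ ∑ x : Fin n → F, (∏ j, e j (x j)) * ε := by
        refine sum_le_sum fun x _ => mul_le_mul_of_nonneg_left ?_ (prod_nonneg fun j _ => hnn _ _)
        have hupd : ∀ a, Function.update x j a ⬝ᵥ D = x ⬝ᵥ D + (a - x j) * D j := by
          intro a
          have : Function.update x j a = x + Pi.single j (a - x j) := by
            ext i
            by_cases hi : i = j
            · subst hi; simp
            · simp [hi]
          rw [this, add_dotProduct, single_dotProduct]
        rw [Finset.sum_eq_single (x j - (x ⬝ᵥ D) / D j)]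
        · rw [if_pos]
          · simpa using hε _
          · rw [hupd]
            field_simp
            ring
        · intro b _ hb
          rw [if_neg, mul_zero]
          intro h
          apply hb
          rw [hupd] at h
          field_simp
          linear_combination h
        · simp
    _ = ε := by rw [← sum_mul, sum_prod_eq_one _ he, one_mul]

/-- The matrix `B` with the rows indexed by `s ∩ J` replaced by the rows of `R` matched to them. -/
def replaceRows (J : Finset (Fin n)) (f : J → Fin r) (B : Matrix (Fin n) (Fin n) F)
    (s : Finset (Fin n)) (R : Fin r → Fin n → F) : Matrix (Fin n) (Fin n) F :=
  fun c => if h : c ∈ J ∧ c ∈ s then R (f ⟨c, h.1⟩) else B c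

open scoped Classical in
-- Rows are replaced one at a time. The new determinant is linear in the new row, and its
-- coefficient at `j` is the previous determinant because row `j` of `B` was a unit vector. If that
-- was nonzero, the matched entry, uniform on nonzero values, hits the one bad value with
-- probability at most 1/(q - 1).
theorem sum_matrixWeight_det_replaceRows_le (J : Finset (Fin n)) (f : J → Fin r)
    (hf : Function.Injective f) (B : Matrix (Fin n) (Fin n) F) (hB : B.det ≠ 0)
    (hBJ : ∀ j ∈ J, B j = Pi.single j 1) {P : Fin r → Fin n → ℝ} (h0 : ∀ i j, 0 ≤ P i j)
    (h1 : ∀ i j, P i j ≤ 1) (hP : ∀ j : J, P (f j) j = 1) (s : Finset (Fin n)) (hs : s ⊆ J) :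
    ∑ R : Fin r → Fin n → F, matrixWeight P R *
        (if (replaceRows J f B s R).det = 0 then 1 else 0) ≤
      #s * (1 / ((Fintype.card F : ℝ) - 1)) := by
  have hq := one_lt_card_real F
  induction s using Finset.induction_on with
  | empty =>
    have : ∀ R : Fin r → Fin n → F, replaceRows J f B ∅ R = B := by
      intro R
      ext c
      simp [replaceRows]
    simp [this, hB]
  | insert j s hjs ih =>
    have hjJ : j ∈ J := hs (mem_insert_self _ _)
    specialize ih fun x hx => hs (mem_insert_of_mem hx)
    -- The cofactors along row `j`.
    set D : (Fin r → Fin n → F) → Fin n → F := fun R c =>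
      ((replaceRows J f B s R).updateRow j (Pi.single c 1)).det with hDdef
    have hrow : ∀ R, replaceRows J f B (insert j s) R =
        (replaceRows J f B s R).updateRow j (R (f ⟨j, hjJ⟩)) := by
      intro R
      ext c : 1
      by_cases hc : c = j
      · subst hc
        rw [Matrix.updateRow_self]
        simp [replaceRows, hjJ]
      · rw [Matrix.updateRow_ne hc]
        simp [replaceRows, hc]
    have hdet : ∀ R, (replaceRows J f B (insert j s) R).det = R (f ⟨j, hjJ⟩) ⬝ᵥ D R := by
      intro R
      rw [hrow, Matrix.det_eq_sum_mul_adjugate_row _ j, dotProduct]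
      refine sum_congr rfl fun c _ => ?_
      rw [Matrix.updateRow_self, Matrix.adjugate_apply, hDdef]
      simp only [Matrix.updateRow_idem]
    have hDj : ∀ R, D R j = (replaceRows J f B s R).det := by
      intro R
      simp only [hDdef]
      congr 1
      rw [← hBJ j hjJ]
      convert Matrix.updateRow_eq_self _ j
      simp [replaceRows, hjs]
    -- Injectivity of `f` means that the row matched to `j` has not been used yet, so `D` does not
    -- depend on it and that row may be resampled.
    have hinv : ∀ R x, replaceRows J f B s (Function.update R (f ⟨j, hjJ⟩) x) =
        replaceRows J f B s R := by
      intro R x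
      ext c : 1
      simp only [replaceRows]
      split_ifs with h
      · rw [Function.update_of_ne]
        intro heq
        have := hf heq
        simp only [Subtype.mk.injEq] at this
        exact hjs (this ▸ h.2)
      · rfl
    have hDinv : ∀ R x, D (Function.update R (f ⟨j, hjJ⟩) x) = D R := by
      intro R x
      simp only [hDdef, hinv]
    have hnn := matrixWeight_nonneg (F := F) h0 h1
    have hnew : ∑ R : Fin r → Fin n → F, matrixWeight P R *
        (if D R j ≠ 0 ∧ R (f ⟨j, hjJ⟩) ⬝ᵥ D R = 0 then 1 else 0) ≤
        1 / ((Fintype.card F : ℝ) - 1) := by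
      have hres := sum_prod_resample
        (fun i (x : Fin n → F) => ∏ j, entryWeight F (P i j) (x j)) (fun _ => sum_rowWeight _)
        (f ⟨j, hjJ⟩) (fun R => if D R j ≠ 0 ∧ R (f ⟨j, hjJ⟩) ⬝ᵥ D R = 0 then 1 else 0)
      simp only [hDinv, Function.update_self] at hres
      refine le_trans (le_of_eq hres) ?_
      calc _ ≤ ∑ R : Fin r → Fin n → F, matrixWeight P R * (1 / ((Fintype.card F : ℝ) - 1)) := by
            refine sum_le_sum fun R _ => mul_le_mul_of_nonneg_left ?_ (hnn R)
            by_cases hD : D R j = 0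
            · simp only [hD, ne_eq, not_true_eq_false, false_and, if_false, mul_zero, sum_const_zero]
              apply div_nonneg zero_le_one; linarith
            · simp only [ne_eq, hD, not_false_eq_true, true_and]
              refine sum_prod_dotProduct_eq_zero_le
                (fun c => entryWeight F (P (f ⟨j, hjJ⟩) c)) (fun _ => sum_entryWeight _)
                (fun c x => entryWeight_nonneg (h0 _ _) (h1 _ _) x) (D R) j hD fun x => ?_
              rw [show P (f ⟨j, hjJ⟩) j = 1 from hP ⟨j, hjJ⟩]
              unfold entryWeight
              split_ifs
              · rw [sub_self]; apply div_nonneg zero_le_one; linarith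
              · exact le_rfl
        _ = _ := by rw [← sum_mul, sum_matrixWeight, one_mul]
    rw [card_insert_of_notMem hjs]
    push_cast
    rw [add_mul, one_mul]
    refine le_trans ?_ (add_le_add ih hnew)
    rw [← sum_add_distrib]
    refine sum_le_sum fun R _ => ?_
    rw [← mul_add, hdet]
    refine mul_le_mul_of_nonneg_left ?_ (hnn R)
    rw [hDj]
    by_cases h1 : (replaceRows J f B s R).det = 0
    · simp only [h1, if_true, ne_eq, not_true_eq_false, false_and, if_false, add_zero]
      split_ifs <;> norm_num
    · simp [h1]

open scoped Classical in
-- A vector of `W` killed by `R` is also killed by the rows of `B` outside `J`, hence by the square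
-- matrix whose rows in `J` are the matched ones; its determinant then vanishes.
theorem sum_matrixWeight_singular_le_of_hasMatching (J : Finset (Fin n))
    (T : Fin r → Fin n → Bool) (hT : HasMatching J T) (B : Matrix (Fin n) (Fin n) F)
    (hB : B.det ≠ 0) (hBJ : ∀ j ∈ J, B j = Pi.single j 1) (W : Set (Fin n → F))
    (hW : ∀ w ∈ W, ∀ c, c ∉ J → B c ⬝ᵥ w = 0) :
    ∑ R : Fin r → Fin n → F, matrixWeight (patternDensity T) R *
        (if Singular W R then 1 else 0) ≤ #J * (1 / ((Fintype.card F : ℝ) - 1)) := by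
  obtain ⟨f, hf, hfT⟩ := hT
  refine le_trans (sum_le_sum fun R _ => ?_) (sum_matrixWeight_det_replaceRows_le J f hf B hB hBJ
    (fun i j => (patternDensity_bounds T i j).1) (fun i j => (patternDensity_bounds T i j).2)
    (fun j => by simp [patternDensity, hfT]) J subset_rfl)
  refine mul_le_mul_of_nonneg_left ?_ (matrixWeight_nonneg
    (fun i j => (patternDensity_bounds T i j).1) (fun i j => (patternDensity_bounds T i j).2) R)
  by_cases hR : Singular W R
  · obtain ⟨w, hw, hw0, hRw⟩ := hR
    have : (replaceRows J f B J R).det = 0 := by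
      rw [← Matrix.exists_mulVec_eq_zero_iff]
      refine ⟨w, hw0, ?_⟩
      ext c
      simp only [Matrix.mulVec, replaceRows, and_self]
      split_ifs with h
      · exact hRw _
      · exact hW w hw c h
    rw [if_pos this]
    split_ifs <;> norm_num
  · rw [if_neg hR]
    split_ifs <;> norm_num

open scoped Classical in
/-- Singularity over a large field is controlled by singularity over another field at the same
density. -/
theorem sum_matrixWeight_singular_le_of_other_field {F' : Type*} [Field F'] [Fintype F']
    (J : Finset (Fin n)) (B : Matrix (Fin n) (Fin n) F)
    (hB : B.det ≠ 0) (hBJ : ∀ j ∈ J, B j = Pi.single j 1) (W : Set (Fin n → F))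
    (hW : ∀ w ∈ W, ∀ c, c ∉ J → B c ⬝ᵥ w = 0) {p : ℝ} (h0 : 0 ≤ p) (h1 : p ≤ 1) :
    ∑ R : Fin r → Fin n → F, matrixWeight (fun _ _ => p) R * (if Singular W R then 1 else 0) ≤
      ∑ R : Fin r → Fin n → F', matrixWeight (fun _ _ => p) R *
        (if Singular {w : Fin n → F' | ∀ j, j ∉ J → w j = 0} R then 1 else 0) +
      #J * (1 / ((Fintype.card F : ℝ) - 1)) := by
  have hq := one_lt_card_real F
  have hε : 0 ≤ (#J : ℝ) * (1 / ((Fintype.card F : ℝ) - 1)) :=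
    mul_nonneg (Nat.cast_nonneg _) (div_nonneg zero_le_one (by linarith))
  refine le_trans ?_ (add_le_add_left
    (sum_patternWeight_not_hasMatching_le (F := F') (r := r) J h0 h1) _)
  rw [sum_matrixWeight_mul_eq_sum_pattern]
  calc _ ≤ ∑ T : Fin r → Fin n → Bool, (patternWeight p T * (if HasMatching J T then 0 else 1) +
        patternWeight p T * (#J * (1 / ((Fintype.card F : ℝ) - 1)))) := by
        refine sum_le_sum fun T _ => ?_
        rw [← mul_add]
        refine mul_le_mul_of_nonneg_left ?_ (patternWeight_nonneg h0 h1 T)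
        by_cases hT : HasMatching J T
        · rw [if_pos hT, zero_add]
          exact sum_matrixWeight_singular_le_of_hasMatching J T hT B hB hBJ W hW
        · rw [if_neg hT]
          refine le_trans ?_ (le_add_of_nonneg_right hε)
          refine le_trans ?_ (le_of_eq (sum_matrixWeight (F := F) (patternDensity T)))
          refine sum_le_sum fun R _ => ?_
          have := matrixWeight_nonneg (F := F) (fun i j => (patternDensity_bounds T i j).1)
            (fun i j => (patternDensity_bounds T i j).2) R
          split_ifs
          · simp
          · simpa using this
    _ = _ := by rw [sum_add_distrib, ← sum_mul, sum_patternWeight, one_mul]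

end Patterns

/-! ### Free coordinates of the kernel and completion to an invertible matrix. -/

section LinearAlgebra

variable {F : Type*} [Field F] {m n : ℕ}

/-- `J` is the complement of a set of columns forming a basis of the column space: a kernel vector
vanishing on `J` is a linear relation among basis columns. -/
theorem exists_complement_columns (A : Matrix (Fin m) (Fin n) F) (hA : A.rank = m) :
    ∃ J : Finset (Fin n), #J = n - m ∧
      ∀ w : Fin n → F, A.mulVec w = 0 → (∀ j ∈ J, w j = 0) → w = 0 := by
  classical
  obtain ⟨κ, a, ha, hspan, hli⟩ := exists_linearIndependent' F A.col
  have : Finite κ := Finite.of_injective a ha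
  have := Fintype.ofFinite κ
  have hκ : Fintype.card κ = m := by
    rw [← finrank_span_eq_card hli, hspan, ← Matrix.rank_eq_finrank_span_cols, hA]
  refine ⟨(univ.map ⟨a, ha⟩)ᶜ, ?_, ?_⟩
  · rw [card_compl, card_map, card_univ, hκ, Fintype.card_fin]
  · intro w hw hwJ
    have hsum : ∑ k, w (a k) • (A.col ∘ a) k = 0 := by
      ext i
      have h := congrFun hw i
      rw [Matrix.mulVec, dotProduct] at h
      rw [← Finset.sum_subset (subset_univ (univ.map ⟨a, ha⟩))] at h
      · rw [sum_map] at h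
        simp only [Finset.sum_apply, Pi.smul_apply, smul_eq_mul, Function.comp]
        rw [← h]
        refine sum_congr rfl fun k _ => ?_
        simp [Matrix.col, mul_comm]
      · intro j _ hj
        rw [hwJ j (by simpa using hj), mul_zero]
    have h0 := Fintype.linearIndependent_iff.1 hli _ hsum
    ext j
    by_cases hj : ∃ k, a k = j
    · obtain ⟨k, rfl⟩ := hj
      exact h0 k
    · exact hwJ j (by simpa using hj)

/-- The rows of `A` are placed outside `J` and unit vectors inside. A vector killed by this matrix
lies in the kernel of `A` and vanishes on `J`. -/
theorem exists_completion (A : Matrix (Fin m) (Fin n) F) (J : Finset (Fin n)) (hmn : m ≤ n)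
    (hJ : #J = n - m)
    (hker : ∀ w : Fin n → F, A.mulVec w = 0 → (∀ j ∈ J, w j = 0) → w = 0) :
    ∃ B : Matrix (Fin n) (Fin n) F, B.det ≠ 0 ∧ (∀ j ∈ J, B j = Pi.single j 1) ∧
      ∀ w, A.mulVec w = 0 → ∀ c, c ∉ J → B c ⬝ᵥ w = 0 := by
  classical
  have hcard : Fintype.card {c // c ∉ J} = Fintype.card (Fin m) := by
    rw [Fintype.card_subtype_compl, Fintype.card_fin, Fintype.card_fin, Fintype.card_coe, hJ]
    omega
  let e := Fintype.equivOfCardEq hcard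
  refine ⟨fun c => if h : c ∈ J then Pi.single c 1 else A (e ⟨c, h⟩), ?_, ?_, ?_⟩
  · intro hdet
    obtain ⟨w, hw0, hw⟩ := Matrix.exists_mulVec_eq_zero_iff.2 hdet
    apply hw0
    apply hker w
    · ext i
      have h := congrFun hw (e.symm i)
      simpa [Matrix.mulVec, (e.symm i).2] using h
    · intro j hj
      have h := congrFun hw j
      simpa [Matrix.mulVec, hj] using h
  · intro j hj
    simp [hj]
  · intro w hw c hc
    simp only [hc, dif_neg, not_false_eq_true]
    exact congrFun hw _

theorem rank_fromRows_eq_of_not_singular {r : ℕ} (A : Matrix (Fin m) (Fin n) F)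
    (R : Matrix (Fin r) (Fin n) F) (h : ¬ Singular {w | A.mulVec w = 0} R) :
    (Matrix.fromRows A R).rank = n := by
  have hinj : Function.Injective (Matrix.fromRows A R).mulVecLin := by
    rw [← LinearMap.ker_eq_bot, LinearMap.ker_eq_bot']
    intro w hw
    by_contra hw0
    rw [Matrix.mulVecLin_apply, Matrix.fromRows_mulVec] at hw
    refine h ⟨w, ?_, hw0, fun i => congrFun hw (Sum.inr i)⟩
    ext i
    exact congrFun hw (Sum.inl i)
  rw [Matrix.rank, LinearMap.finrank_range_of_inj hinj]
  simp

theorem coe_ker_mulVecLin (A : Matrix (Fin m) (Fin n) F) :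
    (LinearMap.ker A.mulVecLin : Set (Fin n → F)) = {w | A.mulVec w = 0} := by
  ext w
  simp

end LinearAlgebra

/-! ### The distribution, its expected cost, and the rank event. -/

section Distribution

variable {F : Type*} [Field F] [Fintype F] {m r n : ℕ}

/-- The distribution of an `r × n` matrix with independent entries of density `p`. -/
noncomputable def matrixDist (F : Type*) [Field F] [Fintype F] (r n : ℕ) (p : ℝ) (h0 : 0 ≤ p)
    (h1 : p ≤ 1) : PMF (Matrix (Fin r) (Fin n) F) :=
  PMF.ofFintype (α := Fin r → Fin n → F)
    (fun R => ENNReal.ofReal (matrixWeight (fun _ _ => p) R)) (by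
      rw [← ENNReal.ofReal_sum_of_nonneg, sum_matrixWeight, ENNReal.ofReal_one]
      exact fun R _ => matrixWeight_nonneg (fun _ _ => h0) (fun _ _ => h1) R)

theorem matrixDist_apply_toReal (p : ℝ) (h0 : 0 ≤ p) (h1 : p ≤ 1) (R : Fin r → Fin n → F) :
    (matrixDist F r n p h0 h1 R).toReal = matrixWeight (fun _ _ => p) R :=
  ENNReal.toReal_ofReal (matrixWeight_nonneg (fun _ _ => h0) (fun _ _ => h1) R)

theorem expectedNonzeroEntries_matrixDist (p : ℝ) (h0 : 0 ≤ p) (h1 : p ≤ 1) :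
    expectedNonzeroEntries (matrixDist F r n p h0 h1) = r * n * p := by
  classical
  have hentry : ∑ a : F, entryWeight F p a * (if a ≠ 0 then 1 else 0) = p := by
    have hq := one_lt_card_real F
    rw [sum_entryWeight_mul, sum_ite, sum_const, nsmul_eq_mul, card_nonzero_real]
    simp
    field_simp [show (Fintype.card F : ℝ) - 1 ≠ 0 by linarith]
  have hrow : ∑ x : Fin n → F, (∏ j, entryWeight F p (x j)) * (hammingNorm x : ℝ) = n * p := by
    have : ∀ x : Fin n → F, (hammingNorm x : ℝ) = ∑ j, if x j ≠ 0 then 1 else 0 := by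
      intro x
      rw [Finset.sum_boole]
      unfold hammingNorm
      congr!
    simp only [this, mul_sum]
    rw [sum_comm]
    simp only [sum_prod_apply (fun _ : Fin n => entryWeight F p) (fun _ => sum_entryWeight p) _
      (fun a => if a ≠ 0 then 1 else 0), hentry]
    simp
  unfold expectedNonzeroEntries
  refine Eq.trans (b := ∑ R : Fin r → Fin n → F, matrixWeight (fun _ _ => p) R *
    ∑ i, (hammingNorm (R i) : ℝ)) ?_ ?_
  · refine Fintype.sum_congr _ _ fun R => ?_
    refine congrArg₂ _ (matrixDist_apply_toReal p h0 h1 R) ?_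
    unfold nonzeroEntries
    push_cast
    congr!
  · simp only [mul_sum]
    rw [sum_comm]
    have := fun i : Fin r => sum_prod_apply
      (fun _ (x : Fin n → F) => ∏ j, entryWeight F p (x j)) (fun _ => sum_rowWeight _) i
      (fun x => (hammingNorm x : ℝ))
    unfold matrixWeight
    simp only [this, hrow]
    simp [mul_assoc]

open scoped Classical in
theorem one_sub_le_probFullRank (p : ℝ) (h0 : 0 ≤ p) (h1 : p ≤ 1)
    (A : Matrix (Fin m) (Fin n) F) {ε : ℝ}
    (h : ∑ R : Fin r → Fin n → F, matrixWeight (fun _ _ => p) R *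
      (if Singular {w | A.mulVec w = 0} R then 1 else 0) ≤ ε) :
    1 - ε ≤ probFullRank (matrixDist F r n p h0 h1) A := by
  have hnn := matrixWeight_nonneg (F := F) (r := r) (n := n) (fun _ _ => h0) (fun _ _ => h1)
  have hfin : probFullRank (matrixDist F r n p h0 h1) A = ∑ R : Fin r → Fin n → F,
      if (Matrix.fromRows A R).rank = n then matrixWeight (fun _ _ => p) R else 0 := by
    unfold probFullRank
    rw [PMF.toOuterMeasure_apply_fintype, ENNReal.toReal_sum]
    · refine Fintype.sum_congr _ _ fun R => ?_
      rw [Set.indicator_apply]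
      simp only [Set.mem_ofPred_eq]
      split_ifs
      · exact matrixDist_apply_toReal p h0 h1 R
      · rfl
    · intro R _
      rw [Set.indicator_apply]
      split_ifs
      · exact PMF.apply_ne_top _ _
      · simp
  rw [hfin, sub_le_iff_le_add]
  refine le_trans ?_ (add_le_add_right h _)
  refine le_trans (le_of_eq (sum_matrixWeight (F := F) (r := r) (n := n) fun _ _ => p).symm) ?_
  rw [← sum_add_distrib]
  refine sum_le_sum fun R _ => ?_
  by_cases hR : Singular {w | A.mulVec w = 0} R
  · simp only [hR, if_true, mul_one]
    have := hnn R
    split_ifs <;> linarith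
  · simp [hR, rank_fromRows_eq_of_not_singular A R hR]

end Distribution

/-! ### Estimates of the union bound by ranges of weights. -/

section Numerics

open scoped Classical in
-- The -1 comes from excluding the zero vector; it is what makes the light range contribute little.
theorem sum_vanishProb_pow_le {F : Type*} [Field F] [Fintype F] {ι : Type*} [Fintype ι]
    [DecidableEq ι] {π x₁ x₂ c₂ c₃ : ℝ} {r : ℕ} (hc₂ : 0 ≤ c₂) (hc₃ : 0 ≤ c₃)
    (h : ∀ i, 1 ≤ i → vanishProb (Fintype.card F) π i ^ r ≤ x₁ ^ i + c₂ * x₂ ^ i + c₃) :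
    ∑ v : ι → F, (if v = 0 then 0 else vanishProb (Fintype.card F) π (hammingNorm v) ^ r) ≤
      ((1 + ((Fintype.card F : ℝ) - 1) * x₁) ^ Fintype.card ι - 1) +
        c₂ * (1 + ((Fintype.card F : ℝ) - 1) * x₂) ^ Fintype.card ι +
        c₃ * (Fintype.card F : ℝ) ^ Fintype.card ι := by
  have hterm : ∀ v : ι → F,
      (if v = 0 then 0 else vanishProb (Fintype.card F) π (hammingNorm v) ^ r) ≤
        (x₁ ^ hammingNorm v - (if v = 0 then 1 else 0)) + c₂ * x₂ ^ hammingNorm v + c₃ := by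
    intro v
    by_cases hv : v = 0
    · subst hv
      simp
      linarith
    · have := h (hammingNorm v) (hammingNorm_pos_iff.2 hv)
      simpa [hv] using this
  refine le_trans (sum_le_sum fun v _ => hterm v) (le_of_eq ?_)
  rw [sum_add_distrib, sum_add_distrib, sum_sub_distrib, ← mul_sum, sum_pow_hammingNorm,
    sum_pow_hammingNorm]
  simp [mul_comm]

/-- An upper bound for `vanishProb` at a real value `β` of `π * i`. -/
noncomputable def vanishBound (q : ℕ) (β : ℝ) : ℝ :=
  1 / (q : ℝ) + (1 - 1 / (q : ℝ)) * Real.exp (-β)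

theorem one_div_cast_bounds {q : ℕ} (hq : 2 ≤ q) : 0 < 1 / (q : ℝ) ∧ 1 / (q : ℝ) ≤ 1 / 2 := by
  have : (2 : ℝ) ≤ q := by exact_mod_cast hq
  exact ⟨by positivity, one_div_le_one_div_of_le (by norm_num) this⟩

theorem vanishBound_pos {q : ℕ} (hq : 2 ≤ q) (β : ℝ) : 0 < vanishBound q β := by
  have h := one_div_cast_bounds hq
  have := Real.exp_pos (-β)
  have : 0 ≤ (1 - 1 / (q : ℝ)) * Real.exp (-β) := mul_nonneg (by linarith) this.le
  unfold vanishBound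
  linarith

theorem vanishBound_antitone {q : ℕ} (hq : 2 ≤ q) : Antitone (vanishBound q) := by
  intro a b hab
  have h := one_div_cast_bounds hq
  have : Real.exp (-b) ≤ Real.exp (-a) := Real.exp_le_exp.2 (by linarith)
  have := mul_le_mul_of_nonneg_left this (show 0 ≤ 1 - 1 / (q : ℝ) by linarith)
  unfold vanishBound
  linarith

theorem vanishProb_le_vanishBound {q : ℕ} (hq : 2 ≤ q) {π : ℝ} (h1 : π ≤ 1) (i : ℕ) :
    vanishProb q π i ≤ vanishBound q (π * i) := by
  have h := one_div_cast_bounds hq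
  have h2 : (1 - π) ^ i ≤ Real.exp (-(π * i)) := by
    calc (1 - π) ^ i ≤ Real.exp (-π) ^ i :=
          pow_le_pow_left₀ (by linarith) (Real.one_sub_le_exp_neg π) i
      _ = _ := by rw [← Real.exp_nat_mul]; ring_nf
  have := mul_le_mul_of_nonneg_left h2 (show 0 ≤ 1 - 1 / (q : ℝ) by linarith)
  unfold vanishProb vanishBound
  linarith

/-- The product is a nonnegative combination of the exponentials with rates c and c - 1, hence
convex in β, so it suffices to check the ends of each range. -/
theorem exp_mul_vanishBound_le_max {q : ℕ} (hq : 2 ≤ q) (c : ℝ) {a b β C : ℝ} (ha : a ≤ β)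
    (hb : β ≤ b) (hCa : Real.exp (c * a) * vanishBound q a ≤ C)
    (hCb : Real.exp (c * b) * vanishBound q b ≤ C) :
    Real.exp (c * β) * vanishBound q β ≤ C := by
  have h := one_div_cast_bounds hq
  have hexp : ∀ d : ℝ, ConvexOn ℝ Set.univ fun x => Real.exp (d * x) := fun d =>
    convexOn_exp.comp_linearMap (LinearMap.lsmul ℝ ℝ d)
  have hconv : ConvexOn ℝ Set.univ fun x => Real.exp (c * x) * vanishBound q x := by
    have := ((hexp c).smul h.1.le).add
      ((hexp (c - 1)).smul (show 0 ≤ 1 - 1 / (q : ℝ) by linarith))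
    refine this.congr fun x _ => ?_
    simp only [vanishBound, Pi.add_apply, smul_eq_mul]
    rw [show (c - 1) * x = c * x + -x by ring, Real.exp_add]
    ring
  exact (hconv.le_max_of_mem_Icc (Set.mem_univ _) (Set.mem_univ _) ⟨ha, hb⟩).trans
    (max_le hCa hCb)

/-- The rate `t` is chosen so that the M-th power of exp(t y) is exactly s^i; a bound on the tilted
function thus becomes geometric decay in the weight. -/
theorem pow_le_of_exp_mul_le {y g C t s : ℝ} {i M : ℕ} (hM : 0 < M) {L : ℝ}
    (hL : 0 < L) (hg : 0 < g) (hs : 0 < s) (ht : t = Real.log s / L)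
    (hy : y = L / M * i) (h : Real.exp (t * y) * g ≤ C) : g ^ M ≤ C ^ M * (1 / s) ^ i := by
  have hM' : (0 : ℝ) < M := by exact_mod_cast hM
  have h1 : (Real.exp (t * y)) ^ M = s ^ i := by
    rw [← Real.exp_nat_mul, ht, hy, show (M : ℝ) * (Real.log s / L * (L / M * i)) =
      i * Real.log s by field_simp, Real.exp_nat_mul, Real.exp_log hs]
  have h2 := pow_le_pow_left₀ (mul_pos (Real.exp_pos _) hg).le h M
  rw [mul_pow, h1] at h2
  rw [one_div, inv_pow, ← div_eq_mul_inv, le_div_iff₀ (pow_pos hs i)]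
  linarith

/-- With β = πi the ranges are β ≤ 1, 1 ≤ β ≤ ln(qM) and β ≥ ln(qM), one summand for each. The
hypotheses are the endpoint checks. The rate 1/(10q) sums to at most (11/10)^k, which 9/11 turns
into a power of 9/10. -/
theorem vanishProb_pow_le {q k M : ℕ} {L : ℝ} (hq : 2 ≤ q) (hk : 0 < k) (hM : 0 < M)
    (hL : 0 < L) (hLM : L ≤ M)
    (hs : Real.exp (Real.log (100 * k * q) / L) * vanishBound q 1 ≤ 1)
    (hm : Real.exp (Real.log (10 * q) / L) * vanishBound q 1 ≤ 9 / 11)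
    (hl : Real.exp (Real.log (10 * q) / L * Real.log (q * M)) *
      vanishBound q (Real.log (q * M)) ≤ 9 / 11) (i : ℕ) :
    vanishProb q (L / M) i ^ M ≤
      (1 / (100 * k * q : ℝ)) ^ i + (9 / 11) ^ M * (1 / (10 * q : ℝ)) ^ i +
        Real.exp 1 * (1 / (q : ℝ)) ^ M := by
  have hq' : (0 : ℝ) < q := by positivity
  have hM' : (0 : ℝ) < M := by positivity
  have hk' : (0 : ℝ) < k := by positivity
  have hπ : L / M ≤ 1 := by rw [div_le_one hM']; exact hLM
  have h0 := vanishProb_nonneg (show 1 ≤ q by omega) hπ i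
  refine le_trans (pow_le_pow_left₀ h0 (vanishProb_le_vanishBound hq hπ i) M) ?_
  set β := L / M * i with hβ
  have hβ0 : 0 ≤ β := by positivity
  have p1 : (0 : ℝ) ≤ (1 / (100 * k * q : ℝ)) ^ i := by positivity
  have p2 : (0 : ℝ) ≤ (9 / 11) ^ M * (1 / (10 * q : ℝ)) ^ i := by positivity
  have p3 : (0 : ℝ) ≤ Real.exp 1 * (1 / (q : ℝ)) ^ M := by positivity
  rcases le_total β 1 with h1 | h1
  · have h := exp_mul_vanishBound_le_max hq (Real.log (100 * k * q) / L) hβ0 h1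
      (C := 1) (by simp [vanishBound]) (by simpa using hs)
    have := pow_le_of_exp_mul_le hM hL (vanishBound_pos hq β) (by positivity) rfl hβ h
    rw [one_pow, one_mul] at this
    linarith
  · rcases le_total β (Real.log (q * M)) with h2 | h2
    · have h := exp_mul_vanishBound_le_max hq (Real.log (10 * q) / L) h1 h2
        (C := 9 / 11) (by simpa using hm) hl
      have := pow_le_of_exp_mul_le hM hL (vanishBound_pos hq β) (by positivity) rfl hβ h
      linarith
    · have h := vanishBound_antitone hq h2
      -- At β = ln(qM) the exponential equals 1/(qM), so the M-th power exceeds q^(-M) by at most (1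
      -- + 1/M)^M ≤ e.
      have h3 : vanishBound q (Real.log (q * M)) ≤ 1 / q * (1 + 1 / M) := by
        have := one_div_cast_bounds hq
        unfold vanishBound
        rw [Real.exp_neg, Real.exp_log (by positivity)]
        have e : (1 : ℝ) / q * (1 + 1 / M) = 1 / q + 1 * ((q : ℝ) * M)⁻¹ := by
          field_simp
        rw [e]
        gcongr
        linarith
      have h4 : (1 + 1 / (M : ℝ)) ^ M ≤ Real.exp 1 := by
        calc (1 + 1 / (M : ℝ)) ^ M ≤ Real.exp (1 / M) ^ M := by
              gcongr
              have := Real.add_one_le_exp (1 / (M : ℝ))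
              linarith
          _ = _ := by
              rw [← Real.exp_nat_mul]
              congr 1
              field_simp
      have h5 := pow_le_pow_left₀ (vanishBound_pos hq β).le (h.trans h3) M
      rw [mul_pow] at h5
      have h6 := mul_le_mul_of_nonneg_left h4
        (show (0 : ℝ) ≤ (1 / (q : ℝ)) ^ M by positivity)
      linarith

theorem exp_one_le : Real.exp 1 ≤ 2.7182818286 := Real.exp_one_lt_d9.le

theorem exp_inv_le {n : ℕ} (hn : n ≠ 0) {c : ℝ} (hc : 0 ≤ c) (h : 2.7182818286 ≤ c ^ n) :
    Real.exp (1 / n) ≤ c := by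
  have hn' : (n : ℝ) ≠ 0 := by exact_mod_cast hn
  refine le_of_pow_le_pow_left₀ hn hc ?_
  rw [← Real.exp_nat_mul, mul_one_div_cancel hn']
  exact exp_one_le.trans h

theorem log_le_of_le_pow {c : ℝ} (hc : 0 < c) (N : ℕ) (h : c ≤ 2.7 ^ N) : Real.log c ≤ N := by
  rw [Real.log_le_iff_le_exp hc, ← mul_one (N : ℝ), Real.exp_nat_mul]
  refine h.trans (pow_le_pow_left₀ (by norm_num) ?_ N)
  have := Real.exp_one_gt_d9
  linarith

theorem le_log_of_pow_le {c : ℝ} (N : ℕ) (h : 2.7182818286 ^ N ≤ c) : N ≤ Real.log c := by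
  have hc : 0 < c := lt_of_lt_of_le (by positivity) h
  rw [Real.le_log_iff_exp_le hc, ← mul_one (N : ℝ), Real.exp_nat_mul]
  exact (pow_le_pow_left₀ (Real.exp_pos _).le exp_one_le N).trans h

/-- The admissible field sizes, dimensions and row densities. -/
def Admissible (q k : ℕ) (L : ℝ) : Prop :=
  (q = 2 ∧ 3 ≤ Real.log k ∧ 13 * Real.log k + 4 ≤ L) ∨
    (3 ≤ q ∧ 4 ≤ Real.log k ∧ 13 / 2 * Real.log k + 4 ≤ L ∧
      (q ≤ k ∨ 5 ≤ Real.log k ∧ q ≤ 20 * k))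

theorem vanishBound_one_le {q a : ℕ} (ha : 2 ≤ a) (hq : a ≤ q) :
    vanishBound q 1 ≤ 0.3679 + 0.6322 / a := by
  have ha' : (0 : ℝ) < a := by positivity
  have hq' : (a : ℝ) ≤ q := by exact_mod_cast hq
  have h1 : 1 / (q : ℝ) ≤ 1 / a := one_div_le_one_div_of_le ha' hq'
  have h2 := Real.exp_neg_one_lt_d9
  have h3 := Real.exp_neg_one_gt_d9
  have e : vanishBound q 1 = Real.exp (-1) + (1 - Real.exp (-1)) * (1 / q) := by
    unfold vanishBound; ring
  rw [e, show (0.6322 : ℝ) / a = 0.6322 * (1 / a) by ring]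
  have h4 : (1 - Real.exp (-1)) * (1 / (q : ℝ)) ≤ 0.6322 * (1 / a) := by
    have : (0 : ℝ) ≤ 1 / q := by positivity
    exact mul_le_mul (by linarith) h1 this (by norm_num)
  linarith

theorem small_weight_bound {q k : ℕ} {L : ℝ} (hk : 0 < k) (h : Admissible q k L) :
    Real.exp (Real.log (100 * k * q) / L) * vanishBound q 1 ≤ 1 := by
  have hk' : (0 : ℝ) < k := by positivity
  have key : ∀ {n : ℕ} {c : ℝ}, n ≠ 0 → 0 < L → 0 < c → 2.7182818286 ≤ c ^ n →
      n * Real.log (100 * k * q) ≤ L → vanishBound q 1 ≤ 1 / c → 2 ≤ q →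
      Real.exp (Real.log (100 * k * q) / L) * vanishBound q 1 ≤ 1 := by
    intro n c hn hL hc hcn hlog hg hq
    have hn' : (0 : ℝ) < n := by positivity
    calc _ ≤ c * (1 / c) := by
          refine mul_le_mul ?_ hg (vanishBound_pos hq 1).le hc.le
          refine le_trans (Real.exp_le_exp.2 ?_) (exp_inv_le hn hc.le hcn)
          rw [div_le_div_iff₀ hL hn']
          linarith
      _ = 1 := by field_simp
  rcases h with ⟨rfl, hx, hL⟩ | ⟨hq, hx, hL, hqk⟩
  · refine key (n := 3) (c := 1.43) (by norm_num) (by linarith) (by norm_num) (by norm_num) ?_ ?_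
      le_rfl
    · rw [show (100 * k * (2 : ℕ) : ℝ) = 200 * k by push_cast; ring,
        Real.log_mul (by norm_num) hk'.ne']
      have := log_le_of_le_pow (c := 200) (by norm_num) 6 (by norm_num)
      push_cast at this ⊢
      linarith
    · refine (vanishBound_one_le le_rfl le_rfl).trans ?_
      norm_num
  · have hq' : (0 : ℝ) < q := by positivity
    refine key (n := 2) (c := 1.7) (by norm_num) (by linarith) (by norm_num) (by norm_num) ?_ ?_
      (by omega)
    · rcases hqk with hqk | ⟨hx5, hqk⟩
      · have h1 : Real.log (100 * k * q) ≤ Real.log (100 * k * k) :=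
          Real.log_le_log (by positivity) (by gcongr)
        rw [Real.log_mul (by positivity) hk'.ne', Real.log_mul (by norm_num) hk'.ne'] at h1
        have := log_le_of_le_pow (c := 100) (by norm_num) 5 (by norm_num)
        push_cast at this ⊢
        linarith
      -- The extra factor 20 is paid for by ln k ≥ 5.
      · have h1 : Real.log (100 * k * q) ≤ Real.log (2000 * k * k) := by
          refine Real.log_le_log (by positivity) ?_
          have : (q : ℝ) ≤ 20 * k := by exact_mod_cast hqk
          nlinarith
        rw [Real.log_mul (by positivity) hk'.ne', Real.log_mul (by norm_num) hk'.ne'] at h1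
        have := log_le_of_le_pow (c := 2000) (by norm_num) 8 (by norm_num)
        push_cast at this ⊢
        linarith
    · refine (vanishBound_one_le (by norm_num) hq).trans ?_
      norm_num

theorem middle_weight_bound {q k : ℕ} {L : ℝ} (hk : 0 < k) (h : Admissible q k L) :
    Real.exp (Real.log (10 * q) / L) * vanishBound q 1 ≤ 9 / 11 := by
  have hk' : (0 : ℝ) < k := by positivity
  have key : ∀ {c g : ℝ}, 0 < L → 0 < c → 2.7182818286 ≤ c ^ 3 →
      3 * Real.log (10 * q) ≤ L → vanishBound q 1 ≤ g → c * g ≤ 9 / 11 → 2 ≤ q →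
      Real.exp (Real.log (10 * q) / L) * vanishBound q 1 ≤ 9 / 11 := by
    intro c g hL hc hcn hlog hg hcg hq
    refine le_trans (mul_le_mul ?_ hg (vanishBound_pos hq 1).le hc.le) hcg
    refine le_trans (Real.exp_le_exp.2 ?_) (exp_inv_le (n := 3) (by norm_num) hc.le hcn)
    rw [div_le_div_iff₀ hL (by norm_num)]
    push_cast
    linarith
  rcases h with ⟨rfl, hx, hL⟩ | ⟨hq, hx, hL, hqk⟩
  · have hlog := log_le_of_le_pow (c := 20) (by norm_num) 4 (by norm_num)
    push_cast at hlog
    calc _ ≤ (1.12 : ℝ) * 0.69 := by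
          refine mul_le_mul ?_ ((vanishBound_one_le le_rfl le_rfl).trans (by norm_num))
            (vanishBound_pos le_rfl 1).le (by norm_num)
          refine le_trans (Real.exp_le_exp.2 ?_)
            (exp_inv_le (n := 10) (by norm_num) (by norm_num) (by norm_num))
          rw [show (10 * (2 : ℕ) : ℝ) = 20 by norm_num, div_le_div_iff₀ (by linarith) (by norm_num)]
          push_cast
          linarith
      _ ≤ _ := by norm_num
  · have hq' : (0 : ℝ) < q := by positivity
    refine key (c := 1.4) (by linarith) (by norm_num) (by norm_num) ?_
      (vanishBound_one_le (by norm_num) hq) (by norm_num) (by omega)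
    rcases hqk with hqk | ⟨hx5, hqk⟩
    · have h1 : Real.log (10 * q) ≤ Real.log (10 * k) :=
        Real.log_le_log (by positivity) (by gcongr)
      rw [Real.log_mul (x := 10) (y := k) (by norm_num) hk'.ne'] at h1
      have := log_le_of_le_pow (c := 10) (by norm_num) 3 (by norm_num)
      push_cast at this
      linarith
    · have h1 : Real.log (10 * q) ≤ Real.log (200 * k) := by
        refine Real.log_le_log (by positivity) ?_
        have : (q : ℝ) ≤ 20 * k := by exact_mod_cast hqk
        linarith
      rw [Real.log_mul (x := 200) (y := k) (by norm_num) hk'.ne'] at h1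
      have := log_le_of_le_pow (c := 200) (by norm_num) 6 (by norm_num)
      push_cast at this
      linarith

theorem large_weight_bound {q k M : ℕ} {L : ℝ} (hk : 0 < k) (h : Admissible q k L)
    (hM : 49 ≤ M) (hMk : 5 * M ≤ 6 * k) :
    Real.exp (Real.log (10 * q) / L * Real.log (q * M)) *
      vanishBound q (Real.log (q * M)) ≤ 9 / 11 := by
  have hk' : (0 : ℝ) < k := by positivity
  have hM' : (49 : ℝ) ≤ M := by exact_mod_cast hM
  have hMk' : (M : ℝ) ≤ 6 / 5 * k := by
    have : (5 * M : ℝ) ≤ 6 * k := by exact_mod_cast hMk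
    linarith
  have hq : 2 ≤ q := by rcases h with h | h <;> omega
  have hq' : (2 : ℝ) ≤ q := by exact_mod_cast hq
  have hL : 0 < L := by
    rcases h with ⟨-, hx, hL⟩ | ⟨-, hx, hL, -⟩ <;> linarith
  have hlog0 : 0 ≤ Real.log (10 * q) := Real.log_nonneg (by linarith)
  -- The fraction a/b bounds ln(qM)/L. The exponential is then at most 4q/5 and `vanishBound` at
  -- most (50/49)/q, since M ≥ 49; the product 40/49 is just below 9/11.
  have key : ∀ a b : ℕ, 0 < b → b * Real.log (q * M) ≤ a * L →
      (10 * (q : ℝ)) ^ a ≤ (4 / 5 * q) ^ b →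
      Real.exp (Real.log (10 * q) / L * Real.log (q * M)) *
        vanishBound q (Real.log (q * M)) ≤ 9 / 11 := by
    intro a b hb hβ hab
    have hb' : (0 : ℝ) < b := by positivity
    have h1 : Real.exp (Real.log (10 * q) / L * Real.log (q * M)) ≤ 4 / 5 * q := by
      refine le_of_pow_le_pow_left₀ hb.ne' (by positivity) (le_trans ?_ hab)
      rw [← Real.exp_log (show (0 : ℝ) < 10 * q by positivity), ← Real.exp_nat_mul,
        ← Real.exp_nat_mul, Real.exp_log (show (0 : ℝ) < 10 * q by positivity)]
      refine Real.exp_le_exp.2 ?_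
      have := mul_le_mul_of_nonneg_left hβ (div_nonneg hlog0 hL.le)
      calc _ = Real.log (10 * q) / L * (b * Real.log (q * M)) := by ring
        _ ≤ _ := this
        _ = _ := by field_simp
    have h3 : vanishBound q (Real.log (q * M)) ≤ 1 / q * (1 + 1 / 49) := by
      have h2 := one_div_cast_bounds hq
      unfold vanishBound
      rw [Real.exp_neg, Real.exp_log (by positivity)]
      have e : (1 : ℝ) / q * (1 + 1 / 49) = 1 / q + 1 * ((q : ℝ) * 49)⁻¹ := by
        field_simp
      rw [e]
      gcongr
      linarith
    calc _ ≤ (4 / 5 * (q : ℝ)) * (1 / q * (1 + 1 / 49)) :=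
          mul_le_mul h1 h3 (vanishBound_pos hq _).le (by positivity)
      _ = 4 / 5 * (1 + 1 / 49) := by field_simp
      _ ≤ _ := by norm_num
  have hβ : ∀ c : ℝ, (q : ℝ) * (6 / 5) ≤ c → Real.log (q * M) ≤ Real.log c + Real.log k := by
    intro c hc
    rw [← Real.log_mul (by linarith) hk'.ne']
    refine Real.log_le_log (by positivity) ?_
    calc (q : ℝ) * M ≤ q * (6 / 5 * k) := by gcongr
      _ = q * (6 / 5) * k := by ring
      _ ≤ c * k := by gcongr
  rcases h with ⟨rfl, hx, hL⟩ | ⟨hq3, hx, hL, hqk⟩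
  · refine key 1 10 (by norm_num) ?_ (by norm_num)
    have h1 := hβ 2.4 (by norm_num)
    have := log_le_of_le_pow (c := 2.4) (by norm_num) 1 (by norm_num)
    push_cast at this h1 ⊢
    linarith
  · have hq3' : (3 : ℝ) ≤ q := by exact_mod_cast hq3
    by_cases hq6 : q ≤ 6
    · have hq6' : (q : ℝ) ≤ 6 := by exact_mod_cast hq6
      refine key 1 5 (by norm_num) ?_ ?_
      · have h1 := hβ 7.2 (by linarith)
        have := log_le_of_le_pow (c := 7.2) (by norm_num) 2 (by norm_num)
        push_cast at this ⊢
        linarith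
      · have : (3 : ℝ) ^ 4 ≤ (q : ℝ) ^ 4 := by gcongr
        nlinarith
    · have hq7 : (7 : ℝ) ≤ q := by exact_mod_cast (by omega : 7 ≤ q)
      refine key 2 5 (by norm_num) ?_ ?_
      · rcases hqk with hqk | ⟨hx5, hqk⟩
        · have hqk' : (q : ℝ) ≤ k := by exact_mod_cast hqk
          have h1 := hβ (1.2 * k) (by linarith)
          rw [Real.log_mul (by norm_num) hk'.ne'] at h1
          have := log_le_of_le_pow (c := 1.2) (by norm_num) 1 (by norm_num)
          push_cast at this ⊢
          linarith
        · have hqk' : (q : ℝ) ≤ 20 * k := by exact_mod_cast hqk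
          have h1 := hβ (24 * k) (by linarith)
          rw [Real.log_mul (by norm_num) hk'.ne'] at h1
          have := log_le_of_le_pow (c := 24) (by norm_num) 4 (by norm_num)
          push_cast at this ⊢
          linarith
      · have h3 : (7 : ℝ) ^ 3 ≤ (q : ℝ) ^ 3 := by gcongr
        have h2 : (0 : ℝ) ≤ (q : ℝ) ^ 2 := by positivity
        nlinarith

end Numerics


/-! ### What the table of constants must satisfy. -/

/-- The properties of the table of constants that the construction uses. -/
structure Constants.Fits (q : ℕ) (c : Constants) : Prop where
  -- 34 is exact for the final sum: 1/50 + 2.72/34 = 1/10.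
  card_pow_ell : 34 ≤ q ^ c.ell
  two_le_ell : 2 ≤ c.ell
  -- Above the threshold this gives r ≤ 6k/5.
  ell_le : 5 * c.ell ≤ c.upsilon
  -- 41 > e^3 and 55 > e^4 supply the bounds on ln k, and 41 + 8 = 49 is the number of rows the
  -- estimates need.
  cases : (q = 2 ∧ 41 ≤ c.upsilon ∧ c.ell = 8 ∧ 13 * (1 - 1 / (q : ℝ)) ≤ c.sigma) ∨
    (3 ≤ q ∧ 55 ≤ c.upsilon ∧ 13 / 2 * (1 - 1 / (q : ℝ)) ≤ c.sigma ∧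
      (q ≤ c.upsilon ∨ 1213 ≤ c.upsilon))
  tau_ge : 4 * (1 - 1 / (q : ℝ)) ≤ c.tau

theorem ite_ind {α : Sort*} (P : α → Prop) {p : Prop} [Decidable p] {a b : α} (ha : p → P a)
    (hb : ¬p → P b) : P (if p then a else b) := by
  split_ifs with h
  exacts [ha h, hb h]

theorem constants_fits {q : ℕ} (hq : 2 ≤ q) : (constants q).Fits q := by
  have hq0 : (0 : ℝ) < q := by positivity
  have h0 : 0 ≤ 1 - 1 / (q : ℝ) := by
    have := one_div_cast_bounds hq
    linarith
  have h1 : 1 - 1 / (q : ℝ) ≤ 1 := by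
    have : 0 < 1 / (q : ℝ) := by positivity
    linarith
  have hsq : 6 ≤ q → 34 ≤ q ^ 2 := fun h => by nlinarith
  have hsmall : ∀ (ℓ υ : ℕ) (s t : ℝ), 3 ≤ q → 34 ≤ q ^ ℓ → 2 ≤ ℓ → 5 * ℓ ≤ υ → 55 ≤ υ →
      q ≤ υ ∨ 1213 ≤ υ → 13 / 2 ≤ s → 4 ≤ t → Constants.Fits q ⟨ℓ, s, t, υ⟩ :=
    fun ℓ υ s t a b c d e f g h => ⟨b, c, d, Or.inr ⟨a, e, by nlinarith, f⟩, by nlinarith⟩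
  have hlarge : ∀ (υ : ℕ) (s t a : ℝ), 6 ≤ q → 55 ≤ υ →
      q ≤ υ ∨ 1213 ≤ υ → s = a * (1 - 1 / (q : ℝ)) → 13 / 2 ≤ a → 4 ≤ t →
      Constants.Fits q ⟨2, s, t, υ⟩ :=
    fun υ s t a b e f g h i => ⟨hsq b, le_rfl, by simp only; omega,
      Or.inr ⟨by omega, e, by rw [g]; nlinarith, f⟩, by nlinarith⟩
  unfold constants
  refine ite_ind (Constants.Fits q) (fun g₂ => ?_) fun g₂ => ?_
  · subst g₂
    constructor <;> norm_num
  refine ite_ind (Constants.Fits q) (fun g₃ => ?_) fun g₃ => ?_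
  · subst g₃
    apply hsmall <;> norm_num
  refine ite_ind (Constants.Fits q) (fun g₄ => ?_) fun g₄ => ?_
  · subst g₄
    apply hsmall <;> norm_num
  refine ite_ind (Constants.Fits q) (fun g₅ => ?_) fun g₅ => ?_
  · subst g₅
    apply hsmall <;> norm_num
  refine ite_ind (Constants.Fits q) (fun g₇ => ?_) fun g₇ => ?_
  · subst g₇
    apply hsmall <;> norm_num
  refine ite_ind (Constants.Fits q) (fun g₈ => ?_) fun g₈ => ?_
  · subst g₈
    apply hsmall <;> norm_num
  refine ite_ind (Constants.Fits q) (fun g₉ => ?_) fun g₉ => ?_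
  · subst g₉
    apply hsmall <;> norm_num
  refine ite_ind (Constants.Fits q) (fun g₁₁ => ?_) fun g₁₁ => ?_
  · subst g₁₁
    apply hsmall <;> norm_num
  refine ite_ind (Constants.Fits q) (fun g₁₃ => ?_) fun g₁₃ => ?_
  · subst g₁₃
    apply hsmall <;> norm_num
  refine ite_ind (Constants.Fits q) (fun g₁₆ => ?_) fun g₁₆ => ?_
  · exact hlarge _ _ _ 9 (by omega) (by norm_num) (by omega) (by field_simp) (by norm_num)
      (by norm_num)
  refine ite_ind (Constants.Fits q) (fun g₂₃ => ?_) fun g₂₃ => ?_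
  · exact hlarge _ _ _ 8 (by omega) (by norm_num) (by omega) (by field_simp) (by norm_num)
      (by norm_num)
  refine ite_ind (Constants.Fits q) (fun g₃₁ => ?_) fun g₃₁ => ?_
  · exact hlarge _ _ _ (15 / 2) (by omega) (by norm_num) (by omega) (by field_simp) (by norm_num)
      (by norm_num)
  refine ite_ind (Constants.Fits q) (fun g₄₇ => ?_) fun g₄₇ => ?_
  · exact hlarge _ _ _ 7 (by omega) (by norm_num) (by omega) (by field_simp) (by norm_num)
      (by norm_num)
  refine ite_ind (Constants.Fits q) (fun g₆₁ => ?_) fun g₆₁ => ?_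
  · exact hlarge _ _ _ (27 / 4) (by omega) (by norm_num) (by omega) (by field_simp)
      (by norm_num) (by norm_num)
  refine ite_ind (Constants.Fits q) (fun g₇₃ => ?_) fun g₇₃ => ?_
  · exact hlarge _ _ _ (33 / 5) (by omega) (by norm_num) (by omega) (by field_simp)
      (by norm_num) (by norm_num)
  exact hlarge _ _ _ (13 / 2) (by omega) (by norm_num) (by omega) (by field_simp)
    (by norm_num) (by norm_num)

/-! ### Failure probability for uniform and for sparse rows. -/

section Singularity

variable {F : Type*} [Field F] [Fintype F] {n : ℕ}

open scoped Classical in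
-- Uniform rows kill every nonzero vector with probability 1/q each, and q^k q^(-r) = q^(-ℓ).
theorem sum_matrixWeight_singular_dense_le (W : Submodule F (Fin n → F)) (J : Finset (Fin n))
    (hJ : ∀ w ∈ W, (∀ j ∈ J, w j = 0) → w = 0) {r ℓ : ℕ} (hr : r = #J + ℓ) :
    ∑ R : Fin r → Fin n → F, matrixWeight (fun _ _ => density F 1) R *
        (if Singular (W : Set (Fin n → F)) R then 1 else 0) ≤
      (1 / (Fintype.card F : ℝ)) ^ ℓ := by
  have hq := one_lt_card_real F
  refine (sum_matrixWeight_singular_le W J hJ zero_le_one le_rfl).trans ?_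
  refine (sum_vanishProb_pow_le (x₁ := 0) (x₂ := 0) (c₂ := 0)
    (c₃ := (1 / (Fintype.card F : ℝ)) ^ r) le_rfl (by positivity) ?_).trans ?_
  · intro i hi
    have : i ≠ 0 := by omega
    simp [vanishProb, this]
  · simp only [mul_zero, add_zero, one_pow, sub_self, zero_mul, Fintype.card_coe, zero_add]
    rw [hr, pow_add, mul_right_comm, ← mul_pow, one_div_mul_cancel (by linarith), one_pow, one_mul]

open scoped Classical in
theorem sum_matrixWeight_singular_sparse_le (W : Submodule F (Fin n → F)) (J : Finset (Fin n))
    (hJ : ∀ w ∈ W, (∀ j ∈ J, w j = 0) → w = 0) {r ℓ : ℕ} (hr : r = #J + ℓ) {L : ℝ} (hpos : 0 < #J)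
    (hadm : Admissible (Fintype.card F) #J L) (hM : 49 ≤ r) (hMk : 5 * ℓ ≤ #J) :
    ∑ R : Fin r → Fin n → F,
        matrixWeight (fun _ _ => density F (min 1 (L / r))) R *
        (if Singular (W : Set (Fin n → F)) R then 1 else 0) ≤
      1 / 50 + 2.72 * (1 / (Fintype.card F : ℝ)) ^ ℓ := by
  have hq := one_lt_card_real F
  have hq2 : 2 ≤ Fintype.card F := Fintype.one_lt_card
  have hM0 : 0 < r := by omega
  have hMR : (0 : ℝ) < (r : ℝ) := by exact_mod_cast hM0
  have hqℓ : (0 : ℝ) ≤ (1 / (Fintype.card F : ℝ)) ^ ℓ := by positivity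
  rcases le_total 1 (L / r) with h1 | h1
  · rw [min_eq_left h1]
    refine (sum_matrixWeight_singular_dense_le W J hJ hr).trans ?_
    linarith
  · rw [min_eq_right h1]
    have hL : 0 < L := by
      rcases hadm with ⟨-, hx, hL⟩ | ⟨-, hx, hL, -⟩ <;> linarith
    have hLM : L ≤ (r : ℝ) := (div_le_one hMR).1 h1
    refine (sum_matrixWeight_singular_le W J hJ (by positivity) h1).trans ?_
    refine (sum_vanishProb_pow_le (by positivity) (by positivity) fun i _ =>
      vanishProb_pow_le hq2 hpos hM0 hL hLM (small_weight_bound hpos hadm)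
        (middle_weight_bound hpos hadm)
        (large_weight_bound hpos hadm hM (by omega)) i).trans ?_
    rw [Fintype.card_coe]
    set q : ℝ := (Fintype.card F : ℝ)
    set k := #J
    have hk : (0 : ℝ) < k := by exact_mod_cast hpos
    have t1 : (1 + (q - 1) * (1 / (100 * k * q))) ^ k ≤ 1.0102 := by
      calc (1 + (q - 1) * (1 / (100 * k * q))) ^ k ≤ Real.exp (1 / 100 / k) ^ k := by
            have hle : (q - 1) * (1 / (100 * k * q)) ≤ 1 / 100 / k := by
              rw [mul_one_div, div_div, div_le_div_iff₀ (by positivity) (by positivity)]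
              nlinarith
            have h0 : 0 ≤ (q - 1) * (1 / (100 * k * q)) :=
              mul_nonneg (by linarith) (by positivity)
            refine pow_le_pow_left₀ (by linarith) ?_ k
            have := Real.add_one_le_exp (1 / 100 / (k : ℝ))
            linarith
        _ = Real.exp (1 / (100 : ℕ)) := by
            rw [← Real.exp_nat_mul]
            congr 1
            push_cast
            field_simp
        _ ≤ 1.0102 := exp_inv_le (by norm_num) (by norm_num) (by norm_num)
    -- Since k ≤ r, this is at most (9/10)^r, and r ≥ 49.
    have t2 : (9 / 11 : ℝ) ^ r * (1 + (q - 1) * (1 / (10 * q))) ^ k ≤ 0.0058 := by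
      have hle : 1 + (q - 1) * (1 / (10 * q)) ≤ 11 / 10 := by
        have : (q - 1) * (1 / (10 * q)) ≤ 1 / 10 := by
          rw [mul_one_div, div_le_div_iff₀ (by positivity) (by positivity)]
          nlinarith
        linarith
      have h0 : 0 ≤ 1 + (q - 1) * (1 / (10 * q)) :=
        add_nonneg zero_le_one (mul_nonneg (by linarith) (by positivity))
      calc _ ≤ (9 / 11 : ℝ) ^ r * (11 / 10) ^ r := by
            refine mul_le_mul_of_nonneg_left ?_ (by positivity)
            refine (pow_le_pow_left₀ h0 hle k).trans ?_
            exact pow_le_pow_right₀ (by norm_num) (by omega)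
        _ = (9 / 10 : ℝ) ^ r := by rw [← mul_pow]; norm_num
        _ ≤ (9 / 10 : ℝ) ^ 49 := pow_le_pow_of_le_one (by norm_num) (by norm_num) hM
        _ ≤ _ := by norm_num
    have t3 : Real.exp 1 * (1 / q) ^ r * q ^ k ≤ 2.72 * (1 / q) ^ ℓ := by
      have e : Real.exp 1 * (1 / q) ^ r * q ^ k = Real.exp 1 * (1 / q) ^ ℓ := by
        rw [hr, pow_add, mul_assoc, mul_right_comm ((1 / q) ^ k), ← mul_pow,
          one_div_mul_cancel (by linarith), one_pow, one_mul]
      rw [e]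
      have := exp_one_le
      exact mul_le_mul_of_nonneg_right (by linarith) hqℓ
    linarith

end Singularity

/-! ### Probability 9/10 in the uniform, sparse and large-field cases. -/

section FullRank

variable {F : Type*} [Field F] [Fintype F] {m n : ℕ}

theorem one_div_pow_le {q ℓ : ℕ} (h : 34 ≤ q ^ ℓ) : (1 / (q : ℝ)) ^ ℓ ≤ 1 / 34 := by
  rw [one_div_pow]
  exact one_div_le_one_div_of_le (by norm_num) (by exact_mod_cast h)

theorem min_one_div_bounds {L : ℝ} (hL : 0 ≤ L) (r : ℕ) :
    0 ≤ min 1 (L / r) ∧ min 1 (L / r) ≤ 1 :=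
  ⟨le_min zero_le_one (by positivity), min_le_left _ _⟩

theorem nine_tenths_le_probFullRank_dense (A : Matrix (Fin m) (Fin n) F) (hA : A.rank = m)
    {ℓ : ℕ} (hℓ : 34 ≤ Fintype.card F ^ ℓ) {p : ℝ} (h0 : 0 ≤ p) (h1 : p ≤ 1)
    (hp : p = density F 1) :
    9 / 10 ≤ probFullRank (matrixDist F (n - m + ℓ) n p h0 h1) A := by
  subst hp
  obtain ⟨J, hJ, hker⟩ := exists_complement_columns A hA
  have h := sum_matrixWeight_singular_dense_le (LinearMap.ker A.mulVecLin) J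
    (fun w hw => hker w (by simpa using hw)) (r := n - m + ℓ) (ℓ := ℓ) (by rw [hJ])
  rw [coe_ker_mulVecLin] at h
  have h2 := one_sub_le_probFullRank _ h0 h1 A (h.trans (one_div_pow_le hℓ))
  linarith

theorem nine_tenths_le_probFullRank_sparse (A : Matrix (Fin m) (Fin n) F) (hA : A.rank = m)
    {ℓ : ℕ} (hℓ : 34 ≤ Fintype.card F ^ ℓ) {L : ℝ} (hpos : 0 < n - m)
    (hadm : Admissible (Fintype.card F) (n - m) L) (hM : 49 ≤ n - m + ℓ) (hMk : 5 * ℓ ≤ n - m)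
    {p : ℝ} (h0 : 0 ≤ p) (h1 : p ≤ 1)
    (hp : p = density F (min 1 (L / (n - m + ℓ : ℕ)))) :
    9 / 10 ≤ probFullRank (matrixDist F (n - m + ℓ) n p h0 h1) A := by
  subst hp
  obtain ⟨J, hJ, hker⟩ := exists_complement_columns A hA
  rw [← hJ] at hadm hpos hMk
  have h := sum_matrixWeight_singular_sparse_le (LinearMap.ker A.mulVecLin) J
    (fun w hw => hker w (by simpa using hw)) (r := n - m + ℓ) (ℓ := ℓ) (by rw [hJ]) hpos hadm hM
    hMk
  rw [coe_ker_mulVecLin] at h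
  have h2 := one_sub_le_probFullRank _ h0 h1 A h
  have h3 := one_div_pow_le hℓ
  linarith

/-- The failure probability is at most 1/50 + 2.72/1156 from `F'` plus 1/20 from the determinant
argument over `F`, in total below 1/10. -/
theorem nine_tenths_le_probFullRank_large {F' : Type*} [Field F'] [Fintype F']
    (hF' : 34 ≤ Fintype.card F') (hmn : m ≤ n)
    (A : Matrix (Fin m) (Fin n) F) (hA : A.rank = m)
    {ℓ : ℕ} (hℓ : 2 ≤ ℓ) {L : ℝ} (hpos : 0 < n - m)
    (hadm : Admissible (Fintype.card F') (n - m) L) (hM : 49 ≤ n - m + ℓ) (hMk : 5 * ℓ ≤ n - m)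
    (hq : 20 * (n - m) < Fintype.card F) {p : ℝ} (h0 : 0 ≤ p) (h1 : p ≤ 1)
    (hp : p = density F' (min 1 (L / (n - m + ℓ : ℕ)))) :
    9 / 10 ≤ probFullRank (matrixDist F (n - m + ℓ) n p h0 h1) A := by
  obtain ⟨J, hJ, hker⟩ := exists_complement_columns A hA
  obtain ⟨B, hB, hBJ, hBA⟩ := exists_completion A J hmn hJ hker
  rw [← hJ] at hadm hpos hMk hq
  let W : Submodule F' (Fin n → F') :=
    { carrier := {w | ∀ j, j ∉ J → w j = 0}
      add_mem' := fun {a b} ha hb j hj => by simp [ha j hj, hb j hj]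
      zero_mem' := fun _ _ => rfl
      smul_mem' := fun c a ha j hj => by simp [ha j hj] }
  have hW : ∀ w ∈ W, (∀ j ∈ J, w j = 0) → w = 0 := by
    intro w hw hwJ
    ext j
    by_cases hj : j ∈ J
    · exact hwJ j hj
    · exact hw j hj
  have h := sum_matrixWeight_singular_sparse_le W J hW (r := n - m + ℓ) (ℓ := ℓ) (by rw [hJ])
    hpos hadm hM hMk
  rw [← hp] at h
  have h2 := sum_matrixWeight_singular_le_of_other_field (F' := F') (r := n - m + ℓ) J B hB hBJ
    {w | A.mulVec w = 0} hBA h0 h1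
  have h3 := one_sub_le_probFullRank _ h0 h1 A (h2.trans (add_le_add_left h _))
  have h4 : (1 / (Fintype.card F' : ℝ)) ^ ℓ ≤ 1 / 1156 := by
    rw [one_div_pow]
    refine one_div_le_one_div_of_le (by norm_num) ?_
    have : (34 : ℝ) ≤ Fintype.card F' := by exact_mod_cast hF'
    calc (1156 : ℝ) = 34 ^ 2 := by norm_num
      _ ≤ (Fintype.card F' : ℝ) ^ 2 := by gcongr
      _ ≤ _ := pow_le_pow_right₀ (by linarith) hℓ
  have h5 : (#J : ℝ) * (1 / ((Fintype.card F : ℝ) - 1)) ≤ 1 / 20 := by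
    have : (20 : ℝ) * #J + 1 ≤ Fintype.card F := by exact_mod_cast hq
    have hJ0 : (0 : ℝ) < #J := by exact_mod_cast hpos
    rw [mul_one_div, div_le_div_iff₀ (by linarith) (by norm_num)]
    linarith
  linarith

/-- The cost of density `(1 - 1 / q') * min 1 (L / r)` with `r` rows of length `n`, compared with
the budget. -/
theorem expected_cost_le {q q' r n k : ℕ} {a b L σ τ : ℝ} (hq' : 2 ≤ q') (hqq : q' ≤ q)
    (hr : 0 < r) (hk : 0 < k) (hkn : k ≤ n) (hL : L = a * Real.log k + b) (ha : 0 ≤ a)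
    (hb : 0 ≤ b) (hσ : a * (1 - 1 / (q : ℝ)) ≤ σ) (hτ : b * (1 - 1 / (q : ℝ)) ≤ τ) :
    (r : ℝ) * n * ((1 - 1 / (q' : ℝ)) * min 1 (L / r)) ≤ σ * n * Real.log n + τ * n := by
  have hr' : (0 : ℝ) < r := by exact_mod_cast hr
  have hk' : (0 : ℝ) < k := by exact_mod_cast hk
  have hk1 : (1 : ℝ) ≤ k := by exact_mod_cast hk
  have hkn' : (k : ℝ) ≤ n := by exact_mod_cast hkn
  have hlog : Real.log k ≤ Real.log n := Real.log_le_log hk' hkn'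
  have hlogk : 0 ≤ Real.log k := Real.log_nonneg hk1
  have h1 := one_div_cast_bounds hq'
  have h2 : 1 - 1 / (q' : ℝ) ≤ 1 - 1 / (q : ℝ) := by
    have : (q' : ℝ) ≤ q := by exact_mod_cast hqq
    have := one_div_le_one_div_of_le (by positivity) this
    linarith
  have h3 : 0 ≤ 1 - 1 / (q : ℝ) := by linarith
  have hL0 : 0 ≤ L := by rw [hL]; positivity
  calc (r : ℝ) * n * ((1 - 1 / (q' : ℝ)) * min 1 (L / r))
      ≤ r * n * ((1 - 1 / (q : ℝ)) * (L / r)) := by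
        refine mul_le_mul_of_nonneg_left ?_ (by positivity)
        exact mul_le_mul h2 (min_le_right _ _) (le_min zero_le_one (by positivity)) h3
    _ = n * ((1 - 1 / (q : ℝ)) * L) := by field_simp
    _ = n * (a * (1 - 1 / (q : ℝ)) * Real.log k + b * (1 - 1 / (q : ℝ))) := by rw [hL]; ring
    _ ≤ n * (σ * Real.log n + τ) := by
        refine mul_le_mul_of_nonneg_left ?_ (by positivity)
        refine add_le_add ?_ hτ
        exact mul_le_mul hσ hlog hlogk (le_trans (mul_nonneg ha h3) hσ)
    _ = _ := by ring

/-- Above the threshold, sparse rows within the budget complete every matrix of full row rank with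
probability at least `9 / 10`. -/
theorem exists_sparse_dist {c : Constants} (hc : c.Fits (Fintype.card F)) (hmn : m ≤ n)
    (hυ : c.upsilon ≤ n - m) :
    ∃ μ : PMF (Matrix (Fin (n - m + c.ell)) (Fin n) F),
      expectedNonzeroEntries μ ≤ c.sigma * n * Real.log n + c.tau * n ∧
        ∀ A : Matrix (Fin m) (Fin n) F, A.rank = m → 9 / 10 ≤ probFullRank μ A := by
  have hq : 2 ≤ Fintype.card F := Fintype.one_lt_card
  have hell := hc.two_le_ell
  have hell5 := hc.ell_le
  have hcases := hc.cases
  have hpos : 0 < n - m := by omega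
  have hM : 49 ≤ n - m + c.ell := by omega
  have hlog : ∀ N : ℕ, (2.7182818286 : ℝ) ^ N ≤ (n - m : ℕ) → (N : ℝ) ≤ Real.log (n - m : ℕ) :=
    fun N => le_log_of_pow_le N
  have main : ∀ a : ℝ, 0 ≤ a → a * (1 - 1 / (Fintype.card F : ℝ)) ≤ c.sigma →
      Admissible (Fintype.card F) (n - m) (a * Real.log (n - m : ℕ) + 4) →
      ∃ μ : PMF (Matrix (Fin (n - m + c.ell)) (Fin n) F),
      expectedNonzeroEntries μ ≤ c.sigma * n * Real.log n + c.tau * n ∧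
        ∀ A : Matrix (Fin m) (Fin n) F, A.rank = m → 9 / 10 ≤ probFullRank μ A := by
    intro a ha haσ hadm
    have hlog0 : 0 ≤ Real.log (n - m : ℕ) := Real.log_natCast_nonneg _
    have hπ := min_one_div_bounds (L := a * Real.log (n - m : ℕ) + 4) (by positivity)
      (n - m + c.ell)
    have hp := density_bounds (F := F) hπ.1 hπ.2
    refine ⟨matrixDist F _ n _ hp.1 hp.2, ?_, fun A hA =>
      nine_tenths_le_probFullRank_sparse A hA hc.card_pow_ell hpos hadm hM (by omega) hp.1 hp.2
        rfl⟩
    rw [expectedNonzeroEntries_matrixDist]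
    exact expected_cost_le hq le_rfl (by omega) hpos (Nat.sub_le _ _) rfl ha (by norm_num) haσ
      hc.tau_ge
  rcases hcases with ⟨hq2, hυ', hell8, hσ⟩ | ⟨hq3, hυ', hσ, hbig⟩
  · refine main 13 (by norm_num) hσ (Or.inl ⟨hq2, ?_, le_rfl⟩)
    refine le_trans (by norm_num) (hlog 3 ?_)
    have : (41 : ℝ) ≤ (n - m : ℕ) := by exact_mod_cast hυ'.trans hυ
    exact le_trans (by norm_num) this
  · have hx4 : 4 ≤ Real.log (n - m : ℕ) := by
      refine le_trans (by norm_num) (hlog 4 ?_)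
      have : (55 : ℝ) ≤ (n - m : ℕ) := by exact_mod_cast hυ'.trans hυ
      exact le_trans (by norm_num) this
    by_cases hqk : Fintype.card F ≤ n - m
    · exact main (13 / 2) (by norm_num) hσ (Or.inr ⟨hq3, hx4, le_rfl, Or.inl hqk⟩)
    -- q > k ≥ υ rules out q ≤ υ, leaving the alternative υ ≥ 1213.
    have h1213 : 1213 ≤ n - m := by omega
    have hx5 : 5 ≤ Real.log (n - m : ℕ) := by
      refine le_trans (by norm_num) (hlog 5 ?_)
      have : (1213 : ℝ) ≤ (n - m : ℕ) := by exact_mod_cast h1213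
      exact le_trans (by norm_num) this
    by_cases hqk' : Fintype.card F ≤ 20 * (n - m)
    · exact main (13 / 2) (by norm_num) hσ (Or.inr ⟨hq3, hx4, le_rfl, Or.inr ⟨hx5, hqk'⟩⟩)
    -- 89 lies below k, so it is admissible, and below q, so its density stays within the budget for
    -- q.
    have : Fact (Nat.Prime 89) := ⟨by norm_num⟩
    have hcard : Fintype.card (ZMod 89) = 89 := ZMod.card 89
    have hπ := min_one_div_bounds (L := 13 / 2 * Real.log (n - m : ℕ) + 4) (by positivity)
      (n - m + c.ell)
    have hp := density_bounds (F := ZMod 89) hπ.1 hπ.2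
    refine ⟨matrixDist F _ n _ hp.1 hp.2, ?_, fun A hA =>
      nine_tenths_le_probFullRank_large (F' := ZMod 89) (by rw [hcard]; norm_num) hmn A hA hell
        hpos (Or.inr ⟨by rw [hcard]; norm_num, hx4, le_rfl, Or.inl (by omega)⟩) hM (by omega)
        (by omega) hp.1 hp.2 rfl⟩
    rw [expectedNonzeroEntries_matrixDist]
    exact expected_cost_le (by rw [hcard]; norm_num) (by omega) (by omega) hpos (Nat.sub_le _ _)
      rfl (by norm_num) (by norm_num) hσ hc.tau_ge

end FullRank

end SparseConditioner

theorem theorem1 {F : Type*} [Field F] [Fintype F] (q : ℕ) (hq : Fintype.card F = q)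
    (ℓ : ℕ) (hℓ : ℓ = (SparseConditioner.constants q).ell)
    (σ : ℝ) (hσ : σ = (SparseConditioner.constants q).sigma)
    (τ : ℝ) (hτ : τ = (SparseConditioner.constants q).tau)
    (υ : ℕ) (hυ : υ = (SparseConditioner.constants q).upsilon)
    (m n : ℕ) (hmn : m ≤ n) :
    ∃ μ : PMF (Matrix (Fin (n - m + ℓ)) (Fin n) F),
      (υ ≤ n - m →
        SparseConditioner.expectedNonzeroEntries μ ≤ σ * n * Real.log n + τ * n) ∧
      (n - m < υ →
        SparseConditioner.expectedNonzeroEntries μ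
            ≤ ((q : ℝ) - 1) / q * ((n : ℝ) - m + ℓ) * n ∧
          ((q : ℝ) - 1) / q * ((n : ℝ) - m + ℓ) * n ≤ ((q : ℝ) - 1) / q * ((υ : ℝ) + ℓ) * n) ∧
      ∀ A : Matrix (Fin m) (Fin n) F, A.rank = m →
        (q ≤ n ^ 2 → 9 / 10 ≤ SparseConditioner.probFullRank μ A) ∧
        (n ^ 2 < q → 9 / 10 - 9 / (10 * (n : ℝ)) ≤ SparseConditioner.probFullRank μ A) := by
  have hq2 : 2 ≤ q := hq ▸ Fintype.one_lt_card
  have hfits := SparseConditioner.constants_fits hq2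
  subst hq hℓ hσ hτ hυ
  set c := SparseConditioner.constants (Fintype.card F)
  -- The bound 9/10 is obtained for every q, so the weaker clause follows; for n = 0 the quotient is
  -- 0.
  have hweak : ∀ x : ℝ, 9 / 10 ≤ x → 9 / 10 - 9 / (10 * (n : ℝ)) ≤ x := by
    intro x hx
    have : 0 ≤ 9 / (10 * (n : ℝ)) := by positivity
    linarith
  by_cases hbig : c.upsilon ≤ n - m
  · obtain ⟨μ, hμ, hrank⟩ := SparseConditioner.exists_sparse_dist hfits hmn hbig
    exact ⟨μ, fun _ => hμ, fun h => absurd h (not_lt.2 hbig),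
      fun A hA => ⟨fun _ => hrank A hA, fun _ => hweak _ (hrank A hA)⟩⟩
  -- Below the threshold the rows are uniform, and their cost equals the stated bound.
  · have hp := SparseConditioner.density_bounds (F := F) zero_le_one le_rfl
    have hrank := fun (A : Matrix (Fin m) (Fin n) F) (hA : A.rank = m) =>
      SparseConditioner.nine_tenths_le_probFullRank_dense A hA hfits.card_pow_ell hp.1 hp.2 rfl
    have hq0 : (1 : ℝ) < Fintype.card F := SparseConditioner.one_lt_card_real F
    refine ⟨SparseConditioner.matrixDist F _ n _ hp.1 hp.2, fun h => absurd h hbig,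
      fun h => ⟨?_, ?_⟩, fun A hA => ⟨fun _ => hrank A hA, fun _ => hweak _ (hrank A hA)⟩⟩
    · rw [SparseConditioner.expectedNonzeroEntries_matrixDist, SparseConditioner.density]
      push_cast [Nat.cast_sub hmn]
      apply le_of_eq
      field_simp
    · have h' : (n : ℝ) - m ≤ c.upsilon := by
        rw [← Nat.cast_sub hmn]
        exact_mod_cast h.le
      have : 0 ≤ ((Fintype.card F : ℝ) - 1) / Fintype.card F :=
        div_nonneg (by linarith) (by linarith)
      gcongr
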